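/- All Hilbert spaces are finite-dimensional and complex. A (bipartite) strategy $S=(|\psi\rangle,\{E_{xa}\},\{F_{yb}\})$ consists of a unit vector $|\psi\rangle\in\mathcal H_A\otimes\mathcal H_B$, a POVM $\{E_{xa}\}_a$ on $\mathcal H_A$ for each input $x$ of Alice, and a POVM $\{F_{yb}\}_b$ on $\mathcal H_B$ for each input $y$ of Bob. A strategy $\tilde S=(|\tilde\psi\rangle,\{\tilde E_{xa}\},\{\tilde F_{yb}\})$ is a local dilation of $S$ if there are isometries $U_A:\mathcal H_A\to\mathcal H_{\tilde A}\otimes\mathcal H_{\hat A}$, $U_B:\mathcal H_B\to\mathcal H_{\tilde B}\otimes\mathcal H_{\hat B}$ and a unit vector $|\mathsf{aux}\rangle\in\mathcal H_{\hat A}\otimes\mathcal H_{\hat B}$ such that, with $U=U_A\otimes U_B$ and for all $x,a,y,b$, $$U|\psi\rangle=|\tilde\psi\rangle|\mathsf{aux}\rangle,\quad U(E_{xa}\otimes 1)|\psi\rangle=\big((\tilde E_{xa}\otimes 1)|\tilde\psi\rangle\big)|\mathsf{aux}\rangle,\quad U(1\otimes F_{yb})|\psi\rangle=\big((1\otimes\tilde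 F_{yb})|\tilde\psi\rangle\big)|\mathsf{aux}\rangle .$$ For a strategy with a mixed state $\rho$ on $\mathcal H_A\otimes\mathcal H_B$, local dilation means that for every purification $|\psi\rangle\in\mathcal H_A\otimes\mathcal H_B\otimes\mathcal H_P$ of $\rho$ there are such $U_A$, $U_B$ and a unit vector $|\mathsf{aux}\rangle\in\mathcal H_{\hat A}\otimes\mathcal H_{\hat B}\otimes\mathcal H_P$ for which the same equations hold with $U=U_A\otimes U_B\otimes 1_P$ and with $E_{xa}$, $F_{yb}$ acting trivially on $\mathcal H_P$. Let $|\phi_4\rangle=\frac12\sum_{i=0}^{3}|ii\rangle\in\mathbb C^4\otimes\mathbb C^4$, $$X_1=\sigma_Z\otimes 1,\quad X_2=\sigma_X\otimes 1,\quad X_3=\sigma_Y\otimes\sigma_Z,\quad X_4=\sigma_Y\otimes\sigma_Y,\qquad Y_{\ell m,\pm}=\tfrac1{\sqrt2}(X_\ell\pm X_m)^{\mathsf T}\quad(1\le\ell<m\le4),$$ and let $S_0=(|\phi_4\rangle,\{X_\ell\},\{Y_{\ell m,\pm}\})$ be the strategy in which Alice (4 inputs) and Bob (12 inputs) measure these hermitian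 unitaries projectively, with outcomes $\pm1$. For a strategy with these inputs and binary outcomes let $A_\ell$, $B_{\ell m,\pm}$ be the observables (the POVM element of outcome $+1$ minus that of outcome $-1$), and consider the sum of six CHSH expressions $$\beta(S)=\sum_{1\le\ell<m\le4}\langle\psi|(A_\ell+A_m)\otimes B_{\ell m,+}+(A_\ell-A_m)\otimes B_{\ell m,-}|\psi\rangle$$ (for a mixed state, $\langle\psi|\cdot|\psi\rangle$ is replaced by $\operatorname{Tr}(\rho\,\cdot)$). Theorem. (1) The $X_\ell$ pairwise anticommute, and there is an injective homomorphism of real unital $*$-algebras $\Phi:M_2(\mathbb H)\to M_4(\mathbb C)$, whose image is the real unital algebra generated by $X_1,\dots,X_4$, such that $\Phi(h_\ell)=X_\ell$, where $$h_1=\begin{pmatrix}1&0\\0&-1\end{pmatrix},\ h_2=\begin{pmatrix}0&1\\1&0\end{pmatrix},\ h_3=\begin{pmatrix}0&-i\\i&0\end{pmatrix},\ h_4=\begin{pmatrix}0&-j\\j&0\end{pmatrix}.$$ (2) $S_0$ is self-tested (in the standard sense, without assumptions on the other strategy) by the Bell inequality $\beta\le12\sqrt2$: every strategy $S$, with a pure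 or a mixed state, satisfies $\beta(S)\le12\sqrt2$; $\beta(S_0)=12\sqrt2$; and if $\beta(S)=12\sqrt2$, then $S_0$ is a local dilation of $S$. (3) $S_0$ is self-conjugate: in every pair of orthonormal bases (in particular in Schmidt bases) there are local unitaries $U_A,U_B$ that carry the matrices of its measurements (by conjugation) and its state (by $U_A\otimes U_B$) to their entrywise complex conjugates. It is not real: there is no pair of orthonormal bases in which its state and all its measurement operators have real entries. -/

import Mathlib

open scoped Matrix Kronecker Quaternion ComplexOrder

noncomputable section

namespace QuaternionSelfTest

/-- A family of POVMs on `ℂ^A` with inputs `I` and outputs `O`. -/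
@[ext]
structure POVM (I O A : Type*) [Fintype O] [Fintype A] [DecidableEq A] where
  E : I → O → Matrix A A ℂ
  pos : ∀ x a, (E x a).PosSemidef
  sum_eq_one : ∀ x, ∑ a, E x a = 1

/-- A (pure-state) bipartite strategy with local Hilbert spaces `ℂ^A` and `ℂ^B`; vectors of
`ℂ^A ⊗ ℂ^B` are functions on `A × B`. -/
@[ext]
structure Strategy (IA OA IB OB A B : Type*) [Fintype OA] [Fintype OB] [Fintype A]
    [DecidableEq A] [Fintype B] [DecidableEq B] where
  ψ : A × B → ℂ
  unit : star ψ ⬝ᵥ ψ = 1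
  alice : POVM IA OA A
  bob : POVM IB OB B

/-- A bipartite strategy whose shared state is a density matrix. -/
structure MixedStrategy (IA OA IB OB A B : Type*) [Fintype OA] [Fintype OB] [Fintype A]
    [DecidableEq A] [Fintype B] [DecidableEq B] where
  ρ : Matrix (A × B) (A × B) ℂ
  pos : ρ.PosSemidef
  trace_eq_one : ρ.trace = 1
  alice : POVM IA OA A
  bob : POVM IB OB B

/-- The product of a vector of `ℂ^A ⊗ ℂ^B` and a vector of `ℂ^A' ⊗ ℂ^B'`, as a vector of
`(ℂ^A ⊗ ℂ^A') ⊗ (ℂ^B ⊗ ℂ^B')`. -/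
def tensorState {A B A' B' : Type*} (v : A × B → ℂ) (aux : A' × B' → ℂ) :
    (A × A') × (B × B') → ℂ :=
  fun q => v (q.1.1, q.2.1) * aux (q.1.2, q.2.2)

/-- `T` is a local dilation of `S`: there are local isometries and an auxiliary state on
`ℂ^kA ⊗ ℂ^kB` carrying `ψ`, `(E_{xa} ⊗ 1) ψ` and `(1 ⊗ F_{yb}) ψ` of `S` to the corresponding vectors
of `T`, tensored with the auxiliary state. -/
def IsLocalDilation {IA OA IB OB A B A' B' : Type*} [Fintype OA] [Fintype OB]
    [Fintype A] [DecidableEq A] [Fintype B] [DecidableEq B]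
    [Fintype A'] [DecidableEq A'] [Fintype B'] [DecidableEq B']
    (S : Strategy IA OA IB OB A B) (T : Strategy IA OA IB OB A' B') : Prop :=
  ∃ (kA kB : ℕ) (UA : Matrix (A' × Fin kA) A ℂ) (UB : Matrix (B' × Fin kB) B ℂ)
    (aux : Fin kA × Fin kB → ℂ),
    UAᴴ * UA = 1 ∧ UBᴴ * UB = 1 ∧ star aux ⬝ᵥ aux = 1 ∧
    (UA ⊗ₖ UB) *ᵥ S.ψ = tensorState T.ψ aux ∧
    (∀ x a, (UA ⊗ₖ UB) *ᵥ ((S.alice.E x a ⊗ₖ (1 : Matrix B B ℂ)) *ᵥ S.ψ) =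
      tensorState ((T.alice.E x a ⊗ₖ (1 : Matrix B' B' ℂ)) *ᵥ T.ψ) aux) ∧
    (∀ y b, (UA ⊗ₖ UB) *ᵥ (((1 : Matrix A A ℂ) ⊗ₖ S.bob.E y b) *ᵥ S.ψ) =
      tensorState (((1 : Matrix A' A' ℂ) ⊗ₖ T.bob.E y b) *ᵥ T.ψ) aux)

/-- `ψ`, a vector of `(ℂ^A ⊗ ℂ^B) ⊗ ℂ^P`, is a purification of `ρ`: tracing out `ℂ^P` gives `ρ`. -/
def IsPurification {A B P : Type*} [Fintype P] (ρ : Matrix (A × B) (A × B) ℂ)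
    (ψ : (A × B) × P → ℂ) : Prop :=
  ∀ i j, ρ i j = ∑ p, ψ (i, p) * star (ψ (j, p))

/-- As `tensorState`, when the auxiliary vector also has a component in the purifying space `ℂ^P`. -/
def tensorStateP {A B A' B' P : Type*} (v : A × B → ℂ) (aux : (A' × B') × P → ℂ) :
    ((A × A') × (B × B')) × P → ℂ :=
  fun q => v (q.1.1.1, q.1.2.1) * aux ((q.1.1.2, q.1.2.2), q.2)

/-- `T` is a local dilation of the mixed-state strategy `S`: for every purification of the state of
`S` there are local isometries on the two sides (acting trivially on the purifying space) as in
`IsLocalDilation`, with an auxiliary state shared with the purifying space. -/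
def IsMixedLocalDilation {IA OA IB OB A B A' B' : Type*} [Fintype OA] [Fintype OB]
    [Fintype A] [DecidableEq A] [Fintype B] [DecidableEq B]
    [Fintype A'] [DecidableEq A'] [Fintype B'] [DecidableEq B']
    (S : MixedStrategy IA OA IB OB A B) (T : Strategy IA OA IB OB A' B') : Prop :=
  ∀ (dP : ℕ) (ψ : (A × B) × Fin dP → ℂ), IsPurification S.ρ ψ →
  ∃ (kA kB : ℕ) (UA : Matrix (A' × Fin kA) A ℂ) (UB : Matrix (B' × Fin kB) B ℂ)
    (aux : (Fin kA × Fin kB) × Fin dP → ℂ),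
    UAᴴ * UA = 1 ∧ UBᴴ * UB = 1 ∧ star aux ⬝ᵥ aux = 1 ∧
    ((UA ⊗ₖ UB) ⊗ₖ (1 : Matrix (Fin dP) (Fin dP) ℂ)) *ᵥ ψ = tensorStateP T.ψ aux ∧
    (∀ x a, ((UA ⊗ₖ UB) ⊗ₖ (1 : Matrix (Fin dP) (Fin dP) ℂ)) *ᵥ
        (((S.alice.E x a ⊗ₖ (1 : Matrix B B ℂ)) ⊗ₖ (1 : Matrix (Fin dP) (Fin dP) ℂ)) *ᵥ ψ) =
      tensorStateP ((T.alice.E x a ⊗ₖ (1 : Matrix B' B' ℂ)) *ᵥ T.ψ) aux) ∧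
    (∀ y b, ((UA ⊗ₖ UB) ⊗ₖ (1 : Matrix (Fin dP) (Fin dP) ℂ)) *ᵥ
        ((((1 : Matrix A A ℂ) ⊗ₖ S.bob.E y b) ⊗ₖ (1 : Matrix (Fin dP) (Fin dP) ℂ)) *ᵥ ψ) =
      tensorStateP (((1 : Matrix A' A' ℂ) ⊗ₖ T.bob.E y b) *ᵥ T.ψ) aux)

/-! Change of orthonormal bases, complex conjugation, realness. -/

/-- The matrices of the POVMs in another orthonormal basis, `E ↦ V E V*`. -/
def POVM.rep {I O A : Type*} [Fintype O] [Fintype A] [DecidableEq A]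
    (M : POVM I O A) (V : Matrix.unitaryGroup A ℂ) : POVM I O A where
  E x a := (V : Matrix A A ℂ) * M.E x a * (V : Matrix A A ℂ)ᴴ
  pos x a := (M.pos x a).mul_mul_conjTranspose_same _
  sum_eq_one x := by
    rw [← Finset.sum_mul, ← Finset.mul_sum, M.sum_eq_one, mul_one]
    exact Matrix.mem_unitaryGroup_iff.mp V.2

/-- The entrywise complex conjugates of the POVMs. -/
def POVM.conj {I O A : Type*} [Fintype O] [Fintype A] [DecidableEq A]
    (M : POVM I O A) : POVM I O A where
  E x a := (M.E x a).map star
  pos x a := by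
    have h : (M.E x a).map star = (M.E x a)ᵀ := by
      conv_rhs => rw [← (M.pos x a).isHermitian.eq]
      rfl
    rw [h]
    exact (M.pos x a).transpose
  sum_eq_one x := by
    have h := congrArg (fun N : Matrix A A ℂ => N.map star) (M.sum_eq_one x)
    ext i j
    have hij := congrFun (congrFun h i) j
    simp only [Matrix.map_apply, Matrix.sum_apply, star_sum] at hij ⊢
    rw [hij]
    by_cases e : i = j <;> simp [Matrix.one_apply, e]

/-- The matrix representation of a strategy in another pair of orthonormal bases:
`E ↦ V E V*`, `F ↦ W F W*`, `ψ ↦ (V ⊗ W) ψ`. As `V`, `W` run over all unitaries, this runs over all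
matrix representations of `S`. -/
def Strategy.rep {IA OA IB OB A B : Type*} [Fintype OA] [Fintype OB]
    [Fintype A] [DecidableEq A] [Fintype B] [DecidableEq B]
    (S : Strategy IA OA IB OB A B) (V : Matrix.unitaryGroup A ℂ) (W : Matrix.unitaryGroup B ℂ) :
    Strategy IA OA IB OB A B where
  ψ := ((V : Matrix A A ℂ) ⊗ₖ (W : Matrix B B ℂ)) *ᵥ S.ψ
  unit := by
    have hV : (V : Matrix A A ℂ)ᴴ * (V : Matrix A A ℂ) = 1 := Matrix.mem_unitaryGroup_iff'.mp V.2
    have hW : (W : Matrix B B ℂ)ᴴ * (W : Matrix B B ℂ) = 1 := Matrix.mem_unitaryGroup_iff'.mp W.2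
    rw [Matrix.star_mulVec, ← Matrix.dotProduct_mulVec, Matrix.mulVec_mulVec,
      Matrix.conjTranspose_kronecker, ← Matrix.mul_kronecker_mul, hV, hW, Matrix.one_kronecker_one,
      Matrix.one_mulVec, S.unit]
  alice := S.alice.rep V
  bob := S.bob.rep W

/-- The entrywise complex conjugate of a strategy. -/
def Strategy.conj {IA OA IB OB A B : Type*} [Fintype OA] [Fintype OB]
    [Fintype A] [DecidableEq A] [Fintype B] [DecidableEq B]
    (S : Strategy IA OA IB OB A B) : Strategy IA OA IB OB A B where
  ψ := star S.ψ
  unit := by rw [star_star, dotProduct_comm]; exact S.unit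
  alice := S.alice.conj
  bob := S.bob.conj

/-- Some matrix representation of `S` is real, that is, equal to its complex conjugate. -/
def Strategy.IsReal {IA OA IB OB A B : Type*} [Fintype OA] [Fintype OB]
    [Fintype A] [DecidableEq A] [Fintype B] [DecidableEq B]
    (S : Strategy IA OA IB OB A B) : Prop :=
  ∃ (V : Matrix.unitaryGroup A ℂ) (W : Matrix.unitaryGroup B ℂ), (S.rep V W).conj = S.rep V W

/-- In every pair of orthonormal bases (so in particular in Schmidt bases), local unitaries carry
`S` to its complex conjugate. -/
def Strategy.IsSelfConjugate {IA OA IB OB A B : Type*} [Fintype OA] [Fintype OB]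
    [Fintype A] [DecidableEq A] [Fintype B] [DecidableEq B]
    (S : Strategy IA OA IB OB A B) : Prop :=
  ∀ (V : Matrix.unitaryGroup A ℂ) (W : Matrix.unitaryGroup B ℂ),
    ∃ (UA : Matrix.unitaryGroup A ℂ) (UB : Matrix.unitaryGroup B ℂ),
      (S.rep V W).rep UA UB = (S.rep V W).conj

/-! Binary measurements and observables. -/

/-- The observable of a binary measurement with outcomes `0` (value `+1`) and `1` (value `-1`). -/
def POVM.obs {I A : Type*} [Fintype A] [DecidableEq A] (M : POVM I (Fin 2) A) (x : I) :
    Matrix A A ℂ :=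
  M.E x 0 - M.E x 1

/-- The binary projective measurements `(1 ± X)/2` of hermitian unitaries `X`. -/
def POVM.ofObs {I A : Type*} [Fintype A] [DecidableEq A] (X : I → Matrix A A ℂ)
    (herm : ∀ x, (X x)ᴴ = X x) (sq : ∀ x, X x * X x = 1) : POVM I (Fin 2) A where
  E x a := (1 / 2 : ℂ) • (1 + (-1 : ℂ) ^ (a : ℕ) • X x)
  pos x a := by
    set P : Matrix A A ℂ := (1 / 2 : ℂ) • (1 + (-1 : ℂ) ^ (a : ℕ) • X x) with hP
    have hs : ((-1 : ℂ) ^ (a : ℕ)) * ((-1 : ℂ) ^ (a : ℕ)) = 1 := by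
      rw [← pow_add, ← two_mul, pow_mul]; norm_num
    have h1 : Pᴴ = P := by
      rw [hP]
      simp [Matrix.conjTranspose_smul, Matrix.conjTranspose_add, herm]
    have h2 : P * P = P := by
      rw [hP]
      simp only [smul_mul_smul_comm, add_mul, mul_add, one_mul, mul_one, sq, hs]
      module
    have h3 : P = Pᴴ * P := by rw [h1, h2]
    rw [h3]
    exact Matrix.posSemidef_conjTranspose_mul_self P
  sum_eq_one x := by
    rw [Fin.sum_univ_two]
    simp only [Fin.val_zero, Fin.val_one, pow_zero, pow_one]
    module

theorem POVM.obs_ofObs {I A : Type*} [Fintype A] [DecidableEq A] (X : I → Matrix A A ℂ)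
    (herm : ∀ x, (X x)ᴴ = X x) (sq : ∀ x, X x * X x = 1) (x : I) :
    (POVM.ofObs X herm sq).obs x = X x := by
  simp only [POVM.obs, POVM.ofObs, Fin.val_zero, Fin.val_one, pow_zero, pow_one]
  module

/-- The CHSH operator `(A₁ + A₂) ⊗ B₁ + (A₁ - A₂) ⊗ B₂`. -/
def chshOp {A B : Type*} (A₁ A₂ : Matrix A A ℂ) (B₁ B₂ : Matrix B B ℂ) :
    Matrix (A × B) (A × B) ℂ :=
  (A₁ + A₂) ⊗ₖ B₁ + (A₁ - A₂) ⊗ₖ B₂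

/-- The pairs `ℓ < m` of indices of Alice's four inputs. -/
abbrev Pair : Type := {p : Fin 4 × Fin 4 // p.1 < p.2}

/-- Bob's twelve inputs: a pair `ℓ < m` and a sign (`0` for `+`, `1` for `-`). -/
abbrev BobInput : Type := Pair × Fin 2

/-- The sum over `ℓ < m` of the six CHSH operators of Alice's observables `ℓ`, `m` and Bob's
observables `(ℓ, m, +)`, `(ℓ, m, -)`. -/
def bellOp {A B : Type*} [Fintype A] [DecidableEq A] [Fintype B] [DecidableEq B]
    (M : POVM (Fin 4) (Fin 2) A) (N : POVM BobInput (Fin 2) B) : Matrix (A × B) (A × B) ℂ :=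
  ∑ p : Pair, chshOp (M.obs p.1.1) (M.obs p.1.2) (N.obs (p, 0)) (N.obs (p, 1))

/-- The value `⟨ψ| bellOp |ψ⟩` of the Bell expression (`bellOp` is hermitian, so taking the real part
only fixes the type). -/
def Strategy.bellValue {A B : Type*} [Fintype A] [DecidableEq A] [Fintype B] [DecidableEq B]
    (S : Strategy (Fin 4) (Fin 2) BobInput (Fin 2) A B) : ℝ :=
  (star S.ψ ⬝ᵥ bellOp S.alice S.bob *ᵥ S.ψ).re

/-- The value `Tr(ρ bellOp)` of the Bell expression. -/
def MixedStrategy.bellValue {A B : Type*} [Fintype A] [DecidableEq A] [Fintype B] [DecidableEq B]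
    (S : MixedStrategy (Fin 4) (Fin 2) BobInput (Fin 2) A B) : ℝ :=
  (S.ρ * bellOp S.alice S.bob).trace.re

/-! The quaternionic strategy. -/

/-- The quaternion unit `i`. -/
def qi : ℍ[ℝ] := ⟨0, 1, 0, 0⟩

/-- The quaternion unit `j`. -/
def qj : ℍ[ℝ] := ⟨0, 0, 1, 0⟩

/-- Generators of the real algebra of `2 × 2` quaternion matrices. -/
def quatGen : Fin 4 → Matrix (Fin 2) (Fin 2) ℍ[ℝ] :=
  ![!![1, 0; 0, -1],
    !![0, 1; 1, 0],
    !![0, -qi; qi, 0],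
    !![0, -qj; qj, 0]]

/-- Alice's observables. -/
def X : Fin 4 → Matrix (Fin 4) (Fin 4) ℂ :=
  ![!![1, 0, 0, 0; 0, 1, 0, 0; 0, 0, -1, 0; 0, 0, 0, -1],
    !![0, 0, 1, 0; 0, 0, 0, 1; 1, 0, 0, 0; 0, 1, 0, 0],
    !![0, 0, -Complex.I, 0; 0, 0, 0, Complex.I; Complex.I, 0, 0, 0; 0, -Complex.I, 0, 0],
    !![0, 0, 0, -1; 0, 0, 1, 0; 0, 1, 0, 0; -1, 0, 0, 0]]

/-- Bob's observables `(X_ℓ ± X_m)ᵀ / √2`. -/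
def Y (y : BobInput) : Matrix (Fin 4) (Fin 4) ℂ :=
  ((1 / √2 : ℝ) : ℂ) • (X y.1.1.1 + (-1 : ℂ) ^ (y.2 : ℕ) • X y.1.1.2)ᵀ

theorem X_herm (l : Fin 4) : (X l)ᴴ = X l := by
  fin_cases l <;> ext i j <;> fin_cases i <;> fin_cases j <;> simp [X]

theorem X_sq (l : Fin 4) : X l * X l = 1 := by
  fin_cases l <;> ext i j <;> fin_cases i <;> fin_cases j <;>
    simp [X]

theorem X_anticomm (l m : Fin 4) (hlm : l < m) : X l * X m + X m * X l = 0 := by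
  fin_cases l <;> fin_cases m <;> first
    | exact absurd hlm (by decide)
    | (ext i j
       fin_cases i <;> fin_cases j <;> simp [X, Matrix.mul_apply, Fin.sum_univ_four])

theorem Y_herm (y : BobInput) : (Y y)ᴴ = Y y := by
  have ht : ∀ l, ((X l)ᵀ)ᴴ = (X l)ᵀ := fun l => by
    change ((X l)ᴴ)ᵀ = (X l)ᵀ
    rw [X_herm]
  simp [Y, Matrix.conjTranspose_smul, Matrix.transpose_add, Matrix.transpose_smul, ht]

theorem Y_sq (y : BobInput) : Y y * Y y = 1 := by
  obtain ⟨⟨⟨l, m⟩, hlm⟩, s⟩ := y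
  have hc : (((1 / √2 : ℝ) : ℂ)) * (((1 / √2 : ℝ) : ℂ)) = 1 / 2 := by
    rw [← Complex.ofReal_mul, div_mul_div_comm, Real.mul_self_sqrt (by norm_num)]
    norm_num
  have hs : ((-1 : ℂ) ^ (s : ℕ)) * ((-1 : ℂ) ^ (s : ℕ)) = 1 := by
    rw [← pow_add, ← two_mul, pow_mul]; norm_num
  have ha : X m * X l = -(X l * X m) := by
    rw [eq_neg_iff_add_eq_zero, add_comm]; exact X_anticomm l m hlm
  have key : (X l + (-1 : ℂ) ^ (s : ℕ) • X m) * (X l + (-1 : ℂ) ^ (s : ℕ) • X m) =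
      (2 : ℂ) • (1 : Matrix (Fin 4) (Fin 4) ℂ) := by
    simp only [add_mul, mul_add, smul_mul_assoc, mul_smul_comm, X_sq, ha]
    simp only [smul_add, smul_neg, smul_smul, hs]
    module
  simp only [Y, smul_mul_smul_comm, ← Matrix.transpose_mul, hc, key]
  simp [Matrix.transpose_smul, smul_smul]

/-- The maximally entangled state `(|00⟩ + |11⟩ + |22⟩ + |33⟩)/2`. -/
def φ₄ : Fin 4 × Fin 4 → ℂ := fun q => if q.1 = q.2 then 1 / 2 else 0

theorem φ₄_unit : star φ₄ ⬝ᵥ φ₄ = 1 := by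
  simp only [dotProduct, Fintype.sum_prod_type, Fin.sum_univ_four, Pi.star_apply, φ₄]
  simp
  norm_num

/-- The strategy `(φ₄, {X_ℓ}, {Y_{ℓm,±}})`. -/
def quatStrategy : Strategy (Fin 4) (Fin 2) BobInput (Fin 2) (Fin 4) (Fin 4) where
  ψ := φ₄
  unit := φ₄_unit
  alice := POVM.ofObs X X_herm X_sq
  bob := POVM.ofObs Y Y_herm Y_sq

end QuaternionSelfTest

end

open scoped Matrix Kronecker Quaternion ComplexOrder

noncomputable section

namespace QuaternionSelfTest

/-! ### The Clifford generators -/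

/-! The algebraic part is a concrete representation `quatRep` of `M₂(ℍ)` on `ℂ⁴`; the elements `h_ℓ`
generate all of `M₂(ℍ)` over the reals, so its image is the real algebra generated by the `X l`.

For the self-test, each CHSH gap `2√2 - CHSH` is a sum of positive terms (`chsh_sumOfSquares`):
squares of differences between Alice's and Bob's operators, and the defects `1 - A²`, `1 - B²` of
non-projective measurements. Maximal value of the sum of six gaps makes every term annihilate the
state. Hence Alice's observables square to one and pairwise anticommute on the state, and Bob has
operators acting on the state as hers do (`mat_relations_of_bellGap`, `exists_bob_obs`). Four
anticommuting square roots of one form a Clifford system, whose only irreducible complex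
representation is `ℂ⁴`. Explicit matrix units therefore give local isometries turning the
observables into `X l ⊗ 1` for Alice and `(X l)ᵀ ⊗ 1` for Bob (`exists_cliffordIsometry`). Viewed as
a matrix, the transformed state commutes with all `X l ⊗ 1`, so it is `1 ⊗ c` by irreducibility:
`φ₄` times an auxiliary state. A mixed state is treated through the components of a purification,
with one pair of isometries serving all of them.

Conjugation is governed by `conjX`, a real unitary that conjugates each `X l` to its transpose and
squares to `-1`. It makes the strategy self-conjugate. A real form would yield an antiunitary
symmetry of square `+1`, whereas irreducibility makes the symmetry unique up to a phase and so
forces the square `-1`. -/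

theorem X_mul_of_ne (l m : Fin 4) (h : l ≠ m) : X l * X m = -(X m * X l) := by
  rcases lt_or_gt_of_ne h with h | h
  · exact eq_neg_of_add_eq_zero_left (X_anticomm l m h)
  · exact eq_neg_of_add_eq_zero_right (X_anticomm m l h)

/-- The generators `X l` act irreducibly. -/
theorem eq_smul_one_of_commute_X (N : Matrix (Fin 4) (Fin 4) ℂ) (h : ∀ l, X l * N = N * X l) :
    N = N 0 0 • (1 : Matrix (Fin 4) (Fin 4) ℂ) := by
  have e : ∀ l i j, (X l * N) i j = (N * X l) i j := fun l i j => by rw [h l]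
  have h0 := e 0
  have h1 := e 1
  have h2 := e 2
  have h3 := e 3
  simp only [Matrix.mul_apply, Fin.sum_univ_four] at h0 h1 h2 h3
  have a02 := h0 0 2
  have a03 := h0 0 3
  have a12 := h0 1 2
  have a13 := h0 1 3
  have a20 := h0 2 0
  have a21 := h0 2 1
  have a30 := h0 3 0
  have a31 := h0 3 1
  have b00 := h1 0 2
  have b01 := h1 0 3
  have b10 := h1 1 2
  have b11 := h1 1 3
  have c01 := h2 0 3
  have c10 := h2 1 2
  have d00 := h3 0 3
  simp [X] at a02 a03 a12 a13 a20 a21 a30 a31 b00 b01 b10 b11 c01 c10 d00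
  -- `X 0` makes `N` block diagonal and `X 1` makes the two blocks equal. `X 2` then forces the
  -- block to commute with `σ_Z`, so it is diagonal, and `X 3` equates its diagonal entries.
  have z01 : N 0 1 = 0 := by
    refine (mul_eq_zero.mp ?_).resolve_left (mul_ne_zero two_ne_zero Complex.I_ne_zero)
    rw [b01] at c01
    linear_combination -c01
  have z10 : N 1 0 = 0 := by
    refine (mul_eq_zero.mp ?_).resolve_left (mul_ne_zero two_ne_zero Complex.I_ne_zero)
    rw [b10] at c10
    linear_combination c10
  ext i j
  fin_cases i <;> fin_cases j <;> simp <;> grind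

/-- The real matrix `1 ⊗ iσ_Y`, which intertwines the `X l` and their complex conjugates. -/
def conjX : Matrix (Fin 4) (Fin 4) ℂ :=
  !![0, 1, 0, 0; -1, 0, 0, 0; 0, 0, 0, 1; 0, 0, -1, 0]

theorem conjX_sq : conjX * conjX = -1 := by
  ext i j; fin_cases i <;> fin_cases j <;> simp [conjX]

theorem conjX_conjTranspose : conjXᴴ = -conjX := by
  ext i j; fin_cases i <;> fin_cases j <;> simp [conjX]

theorem conjX_map_star : conjX.map star = conjX := by
  ext i j; fin_cases i <;> fin_cases j <;> simp [conjX]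

theorem conjX_mem_unitaryGroup : conjX ∈ Matrix.unitaryGroup (Fin 4) ℂ := by
  rw [Matrix.mem_unitaryGroup_iff, Matrix.star_eq_conjTranspose, conjX_conjTranspose,
    mul_neg, conjX_sq, neg_neg]

/-- Three of the generators are symmetric and commute with `1 ⊗ iσ_Y`; `X 2 = σ_Y ⊗ σ_Z` is
antisymmetric and anticommutes with it. -/
theorem conjX_mul_X (l : Fin 4) : conjX * X l = (X l)ᵀ * conjX := by
  fin_cases l <;> ext i j <;> fin_cases i <;> fin_cases j <;>
    simp [conjX, X, Matrix.mul_apply, Fin.sum_univ_four]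

theorem conjX_mul_X_mul (l : Fin 4) : conjX * X l * conjXᴴ = (X l)ᵀ := by
  rw [conjX_mul_X, conjX_conjTranspose, mul_assoc, mul_neg, conjX_sq, neg_neg, mul_one]

theorem conjX_mul_X_transpose_mul (l : Fin 4) : conjX * (X l)ᵀ * conjXᴴ = X l := by
  rw [← conjX_mul_X_mul l, conjX_conjTranspose]
  simp only [mul_neg, neg_mul, neg_neg]
  rw [mul_assoc, mul_assoc, mul_assoc, conjX_sq, ← mul_assoc, ← mul_assoc, conjX_sq]
  simp

/-! ### The quaternionic matrix algebra -/

@[simp] theorem qi_re : qi.re = 0 := rfl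
@[simp] theorem qi_imI : qi.imI = 1 := rfl
@[simp] theorem qi_imJ : qi.imJ = 0 := rfl
@[simp] theorem qi_imK : qi.imK = 0 := rfl
@[simp] theorem qj_re : qj.re = 0 := rfl
@[simp] theorem qj_imI : qj.imI = 0 := rfl
@[simp] theorem qj_imJ : qj.imJ = 1 := rfl
@[simp] theorem qj_imK : qj.imK = 0 := rfl

/-- The representation of `M₂(ℍ)` on `ℂ² ⊗ ℂ²` which sends `i`, `j`, `k` to `iσ_Z`, `iσ_Y`, `iσ_X`
on the second factor. -/
def quatRepFun (M : Matrix (Fin 2) (Fin 2) ℍ[ℝ]) : Matrix (Fin 4) (Fin 4) ℂ :=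
  !![⟨(M 0 0).re, (M 0 0).imI⟩, ⟨(M 0 0).imJ, (M 0 0).imK⟩,
      ⟨(M 0 1).re, (M 0 1).imI⟩, ⟨(M 0 1).imJ, (M 0 1).imK⟩;
    ⟨-(M 0 0).imJ, (M 0 0).imK⟩, ⟨(M 0 0).re, -(M 0 0).imI⟩,
      ⟨-(M 0 1).imJ, (M 0 1).imK⟩, ⟨(M 0 1).re, -(M 0 1).imI⟩;
    ⟨(M 1 0).re, (M 1 0).imI⟩, ⟨(M 1 0).imJ, (M 1 0).imK⟩,
      ⟨(M 1 1).re, (M 1 1).imI⟩, ⟨(M 1 1).imJ, (M 1 1).imK⟩;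
    ⟨-(M 1 0).imJ, (M 1 0).imK⟩, ⟨(M 1 0).re, -(M 1 0).imI⟩,
      ⟨-(M 1 1).imJ, (M 1 1).imK⟩, ⟨(M 1 1).re, -(M 1 1).imI⟩]

theorem quatRepFun_mul (M N : Matrix (Fin 2) (Fin 2) ℍ[ℝ]) :
    quatRepFun (M * N) = quatRepFun M * quatRepFun N := by
  ext i j
  fin_cases i <;> fin_cases j <;>
    (simp only [quatRepFun, Matrix.mul_apply, Fin.sum_univ_four, Fin.sum_univ_two, Fin.zero_eta,
        Fin.mk_one, Fin.reduceFinMk, Matrix.of_apply, Matrix.cons_val]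
     apply Complex.ext <;> simp <;> ring)

/-- The representation of `M₂(ℍ)` on `ℂ⁴` as a homomorphism of real `*`-algebras. -/
def quatRep : Matrix (Fin 2) (Fin 2) ℍ[ℝ] →⋆ₐ[ℝ] Matrix (Fin 4) (Fin 4) ℂ where
  toFun := quatRepFun
  map_one' := by
    ext i j
    fin_cases i <;> fin_cases j <;> apply Complex.ext <;> simp [quatRepFun]
  map_mul' := quatRepFun_mul
  map_zero' := by
    ext i j
    fin_cases i <;> fin_cases j <;> apply Complex.ext <;> simp [quatRepFun]
  map_add' M N := by
    ext i j
    fin_cases i <;> fin_cases j <;> apply Complex.ext <;> simp [quatRepFun] <;> ring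
  commutes' r := by
    ext i j
    fin_cases i <;> fin_cases j <;> apply Complex.ext <;>
      simp [quatRepFun, Matrix.algebraMap_matrix_apply]
  map_star' M := by
    ext i j
    fin_cases i <;> fin_cases j <;> apply Complex.ext <;>
      simp [quatRepFun, Matrix.star_apply]

theorem quatRep_injective : Function.Injective quatRep := by
  intro M N h
  have e : ∀ i j, quatRepFun M i j = quatRepFun N i j := fun i j => congrFun (congrFun h i) j
  have e00 := e 0 0
  have e01 := e 0 1
  have e02 := e 0 2
  have e03 := e 0 3
  have e20 := e 2 0
  have e21 := e 2 1
  have e22 := e 2 2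
  have e23 := e 2 3
  simp [quatRepFun] at e00 e01 e02 e03 e20 e21 e22 e23
  ext i j <;> fin_cases i <;> fin_cases j <;> simp [*]

theorem quatRep_quatGen (l : Fin 4) : quatRep (quatGen l) = X l := by
  change quatRepFun (quatGen l) = X l
  ext i j
  fin_cases l <;> fin_cases i <;> fin_cases j <;> apply Complex.ext <;>
    simp [quatRepFun, quatGen, X]

/-- The products `h₁h₂h₃` and `h₁h₂h₄` are the scalar matrices `i` and `j`, which generate all
quaternion scalars. The projections `(1 ± h₁)/2` are the diagonal matrix units, and multiplying them
by `h₂` gives the off-diagonal ones. -/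
theorem adjoin_quatGen : Algebra.adjoin ℝ (Set.range quatGen) = ⊤ := by
  rw [eq_top_iff]
  intro M _
  set S := Algebra.adjoin ℝ (Set.range quatGen)
  have g : ∀ l, quatGen l ∈ S := fun l => Algebra.subset_adjoin ⟨l, rfl⟩
  have hI : quatGen 0 * quatGen 1 * quatGen 2 ∈ S := S.mul_mem (S.mul_mem (g 0) (g 1)) (g 2)
  have hJ : quatGen 0 * quatGen 1 * quatGen 3 ∈ S := S.mul_mem (S.mul_mem (g 0) (g 1)) (g 3)
  have eI : quatGen 0 * quatGen 1 * quatGen 2 = Matrix.diagonal fun _ => qi := by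
    ext i j <;> fin_cases i <;> fin_cases j <;> simp [quatGen]
  have eJ : quatGen 0 * quatGen 1 * quatGen 3 = Matrix.diagonal fun _ => qj := by
    ext i j <;> fin_cases i <;> fin_cases j <;> simp [quatGen]
  rw [eI] at hI
  rw [eJ] at hJ
  have hq : ∀ q : ℍ[ℝ], (Matrix.diagonal fun _ => q : Matrix (Fin 2) (Fin 2) ℍ[ℝ]) ∈ S := by
    intro q
    have : (Matrix.diagonal fun _ => q : Matrix (Fin 2) (Fin 2) ℍ[ℝ]) =
        q.re • (1 : Matrix (Fin 2) (Fin 2) ℍ[ℝ]) + q.imI • (Matrix.diagonal fun _ => qi) +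
        q.imJ • (Matrix.diagonal fun _ => qj) +
        q.imK • ((Matrix.diagonal fun _ => qi) * (Matrix.diagonal fun _ => qj)) := by
      ext i j <;> fin_cases i <;> fin_cases j <;> simp
    rw [this]
    exact S.add_mem (S.add_mem (S.add_mem (S.smul_mem S.one_mem _) (S.smul_mem hI _))
      (S.smul_mem hJ _)) (S.smul_mem (S.mul_mem hI hJ) _)
  have p0 : (1 / 2 : ℝ) • (1 + quatGen 0) ∈ S := S.smul_mem (S.add_mem S.one_mem (g 0)) _
  have p1 : (1 / 2 : ℝ) • (1 - quatGen 0) ∈ S := S.smul_mem (S.sub_mem S.one_mem (g 0)) _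
  have e0 : (1 / 2 : ℝ) • (1 + quatGen 0) = !![1, 0; 0, 0] := by
    ext i j <;> fin_cases i <;> fin_cases j <;> (simp [quatGen]; try norm_num)
  have e1 : (1 / 2 : ℝ) • (1 - quatGen 0) = !![0, 0; 0, 1] := by
    ext i j <;> fin_cases i <;> fin_cases j <;> (simp [quatGen]; try norm_num)
  rw [e0] at p0
  rw [e1] at p1
  have : M = (Matrix.diagonal fun _ => M 0 0) * !![1, 0; 0, 0] +
      (Matrix.diagonal fun _ => M 0 1) * (!![1, 0; 0, 0] * quatGen 1) +
      (Matrix.diagonal fun _ => M 1 0) * (!![0, 0; 0, 1] * quatGen 1) +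
      (Matrix.diagonal fun _ => M 1 1) * !![0, 0; 0, 1] := by
    ext i j <;> fin_cases i <;> fin_cases j <;> simp [quatGen]
  rw [this]
  exact S.add_mem (S.add_mem (S.add_mem (S.mul_mem (hq _) p0)
    (S.mul_mem (hq _) (S.mul_mem p0 (g 1)))) (S.mul_mem (hq _) (S.mul_mem p1 (g 1))))
    (S.mul_mem (hq _) p1)

theorem range_quatRep :
    Set.range quatRep = (Algebra.adjoin ℝ (Set.range X) : Set (Matrix (Fin 4) (Fin 4) ℂ)) := by
  have h : Set.range X = quatRep.toAlgHom '' Set.range quatGen := by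
    rw [← Set.range_comp]
    congr 1
    funext l
    exact (quatRep_quatGen l).symm
  rw [h, ← AlgHom.map_adjoin, adjoin_quatGen, Algebra.map_top]
  rfl

/-! ### Complex conjugation of the quaternionic strategy -/

theorem conjX_mul_Y_mul (y : BobInput) : conjX * Y y * conjXᴴ = (Y y)ᵀ := by
  simp only [Y, Matrix.transpose_smul, Matrix.transpose_add, Matrix.transpose_transpose,
    Matrix.mul_smul, Matrix.smul_mul, mul_add, add_mul, conjX_mul_X_transpose_mul]

/-- For hermitian matrices the entrywise conjugate is the transpose, so conjugating the observables
to their transposes is enough. -/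
theorem ofObs_rep_eq_conj {I A : Type*} [Fintype A] [DecidableEq A] (Z : I → Matrix A A ℂ)
    (herm : ∀ x, (Z x)ᴴ = Z x) (sq : ∀ x, Z x * Z x = 1) (G : Matrix.unitaryGroup A ℂ)
    (h : ∀ x, (G : Matrix A A ℂ) * Z x * (G : Matrix A A ℂ)ᴴ = (Z x)ᵀ) :
    (POVM.ofObs Z herm sq).rep G = (POVM.ofObs Z herm sq).conj := by
  have hG : (G : Matrix A A ℂ) * (G : Matrix A A ℂ)ᴴ = 1 := Matrix.mem_unitaryGroup_iff.mp G.2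
  have ht : ∀ x, (Z x)ᵀ = (Z x).map star := fun x => by
    conv_lhs => rw [← herm x]
    rfl
  ext x a i j
  simp only [POVM.rep, POVM.conj, POVM.ofObs, Matrix.mul_smul, Matrix.smul_mul, mul_add, add_mul,
    mul_one, hG, h, ht]
  have h2 : (starRingEnd ℂ) 2 = 2 := Complex.conj_ofNat 2
  by_cases hij : i = j <;> simp [hij, h2, mul_add]

theorem Strategy.rep_rep {IA OA IB OB A B : Type*} [Fintype OA] [Fintype OB]
    [Fintype A] [DecidableEq A] [Fintype B] [DecidableEq B] (S : Strategy IA OA IB OB A B)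
    (V V' : Matrix.unitaryGroup A ℂ) (W W' : Matrix.unitaryGroup B ℂ) :
    (S.rep V W).rep V' W' = S.rep (V' * V) (W' * W) := by
  refine Strategy.ext ?_ ?_ ?_
  · simp [Strategy.rep, Matrix.mulVec_mulVec, Matrix.mul_kronecker_mul]
  · ext1
    simp [Strategy.rep, POVM.rep, Matrix.conjTranspose_mul, mul_assoc]
  · ext1
    simp [Strategy.rep, POVM.rep, Matrix.conjTranspose_mul, mul_assoc]

/-- The entrywise complex conjugate of a unitary matrix. -/
def conjUnitary {A : Type*} [Fintype A] [DecidableEq A] (V : Matrix.unitaryGroup A ℂ) :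
    Matrix.unitaryGroup A ℂ :=
  ⟨(V : Matrix A A ℂ).map star, by
    have h : (V : Matrix A A ℂ) * (V : Matrix A A ℂ)ᴴ = 1 := Matrix.mem_unitaryGroup_iff.mp V.2
    rw [Matrix.mem_unitaryGroup_iff, Matrix.star_eq_conjTranspose]
    have h' := congrArg (fun N : Matrix A A ℂ => N.map (starRingEnd ℂ)) h
    simp only [Matrix.map_mul] at h'
    rw [Matrix.map_one _ (map_zero _) (map_one _)] at h'
    exact h'⟩

theorem Strategy.rep_conj {IA OA IB OB A B : Type*} [Fintype OA] [Fintype OB]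
    [Fintype A] [DecidableEq A] [Fintype B] [DecidableEq B] (S : Strategy IA OA IB OB A B)
    (V : Matrix.unitaryGroup A ℂ) (W : Matrix.unitaryGroup B ℂ) :
    (S.rep V W).conj = S.conj.rep (conjUnitary V) (conjUnitary W) := by
  refine Strategy.ext ?_ ?_ ?_
  · funext q
    simp [Strategy.rep, Strategy.conj, conjUnitary, Matrix.mulVec, dotProduct]
  · ext x a i j
    simp [Strategy.rep, Strategy.conj, POVM.rep, POVM.conj, conjUnitary, Matrix.mul_apply,
      Finset.sum_mul]
  · ext x a i j
    simp [Strategy.rep, Strategy.conj, POVM.rep, POVM.conj, conjUnitary, Matrix.mul_apply,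
      Finset.sum_mul]

/-- Besides its action on the observables, `conjX` is real orthogonal, so `conjX ⊗ conjX` fixes
`φ₄`. -/
theorem quatStrategy_rep_conjX :
    quatStrategy.rep ⟨conjX, conjX_mem_unitaryGroup⟩ ⟨conjX, conjX_mem_unitaryGroup⟩ =
      quatStrategy.conj := by
  refine Strategy.ext ?_ ?_ ?_
  · funext q
    obtain ⟨i, j⟩ := q
    fin_cases i <;> fin_cases j <;>
      simp [Strategy.rep, Strategy.conj, quatStrategy, φ₄, conjX, Matrix.mulVec, dotProduct,
        Fintype.sum_prod_type, Fin.sum_univ_four]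
  · exact ofObs_rep_eq_conj X X_herm X_sq _ conjX_mul_X_mul
  · exact ofObs_rep_eq_conj Y Y_herm Y_sq _ conjX_mul_Y_mul

theorem quatStrategy_isSelfConjugate : quatStrategy.IsSelfConjugate := by
  intro V W
  -- The symmetry `conjX` of the standard basis, transported to the basis `V`: undo `V`, apply
  -- `conjX`, and redo the conjugate of `V`.
  refine ⟨conjUnitary V * ⟨conjX, conjX_mem_unitaryGroup⟩ * V⁻¹,
    conjUnitary W * ⟨conjX, conjX_mem_unitaryGroup⟩ * W⁻¹, ?_⟩
  rw [Strategy.rep_rep, Strategy.rep_conj, ← quatStrategy_rep_conjX, Strategy.rep_rep]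
  simp only [inv_mul_cancel_right]

theorem quatStrategy_not_isReal : ¬ quatStrategy.IsReal := by
  rintro ⟨V, W, h⟩
  set v : Matrix (Fin 4) (Fin 4) ℂ := (V : Matrix (Fin 4) (Fin 4) ℂ)
  have hv : vᴴ * v = 1 := Matrix.mem_unitaryGroup_iff'.mp V.2
  have hc : (v.map star)ᴴ * v.map star = 1 := Matrix.mem_unitaryGroup_iff'.mp (conjUnitary V).2
  -- Realness in the basis `V` combined with the symmetry `conjX`.
  have hX : ∀ l, v.map star * (X l)ᵀ * (v.map star)ᴴ = v * X l * vᴴ := by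
    intro l
    have h1 : (quatStrategy.rep (conjUnitary V * ⟨conjX, conjX_mem_unitaryGroup⟩)
        (conjUnitary W * ⟨conjX, conjX_mem_unitaryGroup⟩)).alice.obs l =
        (quatStrategy.rep V W).alice.obs l := by
      rw [← Strategy.rep_rep, quatStrategy_rep_conjX, ← Strategy.rep_conj, h]
    have h2 : ∀ U U' : Matrix.unitaryGroup (Fin 4) ℂ, (quatStrategy.rep U U').alice.obs l =
        (U : Matrix (Fin 4) (Fin 4) ℂ) * X l * (U : Matrix (Fin 4) (Fin 4) ℂ)ᴴ := by
      intro U U'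
      rw [← POVM.obs_ofObs X X_herm X_sq l]
      simp [POVM.obs, Strategy.rep, POVM.rep, quatStrategy, mul_sub, sub_mul]
    have h3 := (h2 _ _).symm.trans (h1.trans (h2 V W))
    rw [← h3, ← conjX_mul_X_mul l]
    simp [conjUnitary, Matrix.conjTranspose_mul, mul_assoc, v]
  -- The conjugation of the supposed real basis and that given by `conjX` differ by a unitary
  -- commuting with all `X l`, hence by a scalar `c`.
  have hN := eq_smul_one_of_commute_X (vᴴ * (v.map star) * conjX) (fun l => by
    have h1 := congrArg (fun N => vᴴ * N * (v.map star) * conjX) (hX l)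
    simp only [mul_assoc] at h1 ⊢
    rw [← mul_assoc ((v.map star)ᴴ), hc, one_mul, ← mul_assoc vᴴ v, hv, one_mul] at h1
    rw [← h1, conjX_mul_X])
  set c := (vᴴ * (v.map star) * conjX) 0 0
  have hv' : v * vᴴ = 1 := Matrix.mem_unitaryGroup_iff.mp V.2
  have h4 : v.map star = -(c • (v * conjX)) := by
    have h1 := congrArg (fun N => v * N * conjX) hN
    simp only [mul_assoc, conjX_sq] at h1
    rw [← mul_assoc v, hv', one_mul] at h1
    simpa [eq_neg_iff_add_eq_zero, neg_eq_iff_add_eq_zero] using h1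
  have h5 : v = -(star c • (v.map star * conjX)) := by
    have h1 := congrArg (fun N : Matrix (Fin 4) (Fin 4) ℂ => N.map star) h4
    ext i j
    have h2 := congrFun (congrFun h1 i) j
    have h3 : ∀ a b, star (conjX a b) = conjX a b := fun a b =>
      congrFun (congrFun conjX_map_star a) b
    simp only [Matrix.map_apply, star_star, Matrix.neg_apply, Matrix.smul_apply, star_neg,
      Matrix.mul_apply, smul_eq_mul, star_mul', star_sum, h3] at h2 ⊢
    exact h2
  -- Conjugating twice returns `v`, but it also gives `|c|² v conjX² = -|c|² v`.
  have h6 : (1 + star c * c) • v = 0 := by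
    conv_lhs => rw [add_smul, one_smul]; lhs; rw [h5, h4]
    simp [mul_assoc, conjX_sq, smul_smul]
  have h7 : (1 + star c * c) ≠ 0 := by
    have : (1 + star c * c) = ((1 + Complex.normSq c : ℝ) : ℂ) := by
      rw [Complex.star_def, ← Complex.normSq_eq_conj_mul_self]; push_cast; rfl
    rw [this, Complex.ofReal_ne_zero]
    have := Complex.normSq_nonneg c
    positivity
  have h8 : v = 0 := (smul_eq_zero.mp h6).resolve_left h7
  rw [h8] at hv
  have := congrFun (congrFun hv 0) 0
  simp at this

/-! ### Representations of the Clifford relations -/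

/-- A right inverse of `M` on its range; `M * Q` is the orthogonal projection onto the range. -/
theorem exists_rangeProjection {m n : Type*} [Fintype m] [DecidableEq m] [Fintype n]
    (M : Matrix m n ℂ) : ∃ Q : Matrix n m ℂ, (M * Q)ᴴ = M * Q ∧ M * Q * M = M := by
  have hA : (M * Mᴴ).IsHermitian := Matrix.isHermitian_mul_conjTranspose_self M
  set U : Matrix m m ℂ := (hA.eigenvectorUnitary : Matrix m m ℂ)
  set d : m → ℂ := RCLike.ofReal ∘ hA.eigenvalues
  have hU : Uᴴ * U = 1 := Matrix.mem_unitaryGroup_iff'.mp hA.eigenvectorUnitary.2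
  have hs : M * Mᴴ = U * Matrix.diagonal d * Uᴴ := by
    conv_lhs => rw [hA.spectral_theorem]
    rfl
  have hd : star d = d := by
    funext i
    simp [d]
  -- Since `0⁻¹ = 0`, the entries `d i * (d i)⁻¹` are `0` or `1`, and `P` is the spectral projection
  -- of `M Mᴴ` onto its nonzero eigenvalues.
  set P : Matrix m m ℂ := U * Matrix.diagonal (fun i => d i * (d i)⁻¹) * Uᴴ
  have hP : M * (Mᴴ * (U * Matrix.diagonal (fun i => (d i)⁻¹) * Uᴴ)) = P := by
    rw [← Matrix.mul_assoc, hs]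
    calc _ = U * Matrix.diagonal d * (Uᴴ * U) * Matrix.diagonal (fun i => (d i)⁻¹) * Uᴴ := by
          simp only [mul_assoc]
      _ = P := by rw [hU, mul_one, mul_assoc U, Matrix.diagonal_mul_diagonal]
  have hPM : P * (M * Mᴴ) = M * Mᴴ := by
    rw [hs]
    calc _ = U * Matrix.diagonal (fun i => d i * (d i)⁻¹) * (Uᴴ * U) * Matrix.diagonal d * Uᴴ := by
          simp only [P, mul_assoc]
      _ = _ := by
          rw [hU, mul_one, mul_assoc U, Matrix.diagonal_mul_diagonal]
          congr 3
          funext i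
          by_cases h : d i = 0 <;> simp [h]
  refine ⟨Mᴴ * (U * Matrix.diagonal (fun i => (d i)⁻¹) * Uᴴ), ?_, ?_⟩
  · rw [hP]
    simp only [P, Matrix.conjTranspose_mul, Matrix.diagonal_conjTranspose,
      Matrix.conjTranspose_conjTranspose, mul_assoc]
    congr 3
    funext i
    have := congrFun hd i
    simp only [Pi.star_apply] at this ⊢
    simp [this]
  · rw [hP]
    have h : (P - 1) * (M * Mᴴ) = 0 := by rw [sub_mul, hPM, one_mul, sub_self]
    rw [Matrix.mul_self_mul_conjTranspose_eq_zero, Matrix.sub_mul, Matrix.one_mul, sub_eq_zero] at h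
    exact h

/-- Four anticommuting hermitian square roots of a projection `e`, as elements of the corner `eRe`. -/
structure CliffordSystem {R : Type*} [Ring R] [StarRing R] (e : R) (a : Fin 4 → R) : Prop where
  star_e : star e = e
  mul_e : e * e = e
  star_a : ∀ l, star (a l) = a l
  e_mul_a : ∀ l, e * a l = a l
  a_mul_e : ∀ l, a l * e = a l
  sq : ∀ l, a l * a l = e
  anticomm : ∀ l m, l ≠ m → a l * a m = -(a m * a l)

namespace CliffordSystem

variable {R : Type*} [Ring R] [StarRing R] [Algebra ℂ R] [StarModule ℂ R] {e : R} {a : Fin 4 → R}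

/-- The first matrix unit `|0⟩⟨0|` of the representation of `M₄(ℂ)` given by a Clifford system. -/
def corner (e : R) (a : Fin 4 → R) : R :=
  (1 / 4 : ℂ) • ((e + a 0) * (e - Complex.I • (a 0 * a 1 * a 2)))

/-- The matrix units `|0⟩⟨i|` of the representation of `M₄(ℂ)` given by a Clifford system. -/
def matrixUnit (e : R) (a : Fin 4 → R) : Fin 4 → R :=
  ![corner e a, corner e a * (Complex.I • (a 2 * a 3)), corner e a * a 1,
    corner e a * (a 1 * (Complex.I • (a 2 * a 3)))]

/-- In the model, `-i X₀X₁X₂ = 1 ⊗ σ_Z`, so `corner` is `|00⟩⟨00|`; right multiplication by `iX₂X₃ =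
1 ⊗ σ_X` and `X₁ = σ_X ⊗ 1` flips the second and the first bit of the bra. The Clifford relations
alone bring all words to a normal form, so the same identities hold for any Clifford system. -/
theorem matrixUnit_mul (h : CliffordSystem e a) (i l : Fin 4) :
    matrixUnit e a i * a l = ∑ j, X l i j • matrixUnit e a j := by
  have s := h.sq
  have ac : ∀ l m x, l ≠ m → a l * (a m * x) = -(a m * (a l * x)) := by
    intro l m x hlm
    rw [← mul_assoc, h.anticomm l m hlm, neg_mul, mul_assoc]
  have sx : ∀ l x, a l * (a l * x) = e * x := fun l x => by rw [← mul_assoc, s]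
  have ex : ∀ l x, e * (a l * x) = a l * x := fun l x => by rw [← mul_assoc, h.e_mul_a]
  have iI : ∀ z : ℂ, Complex.I * (Complex.I * z) = -z := fun z => by
    rw [← mul_assoc, Complex.I_mul_I, neg_one_mul]
  have iI' : ∀ z : ℂ, Complex.I * (z * Complex.I) = -z := fun z => by
    rw [mul_comm z, iI]
  have a10 := h.anticomm 1 0 (by decide)
  have a20 := h.anticomm 2 0 (by decide)
  have a30 := h.anticomm 3 0 (by decide)
  have a21 := h.anticomm 2 1 (by decide)
  have a31 := h.anticomm 3 1 (by decide)
  have a32 := h.anticomm 3 2 (by decide)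
  have b10 := fun x => ac 1 0 x (by decide)
  have b20 := fun x => ac 2 0 x (by decide)
  have b21 := fun x => ac 2 1 x (by decide)
  fin_cases i <;> fin_cases l <;>
    (simp [matrixUnit, corner, X, Fin.sum_univ_four, mul_add, add_mul, mul_sub, sub_mul, mul_assoc,
      h.mul_e, h.e_mul_a, h.a_mul_e, s, sx, ex, a10, a20, a30, a21, a31, a32,
      b10, b20, b21, smul_smul, smul_add,
      smul_sub, iI, iI', neg_smul]; try module)

/-- This is `∑ |i⟩⟨0|0⟩⟨i| = 1` inside the corner `eRe`; it makes the stacked `T i` isometric on the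
range of `e`. -/
theorem sum_star_matrixUnit_mul (h : CliffordSystem e a) :
    ∑ i, star (matrixUnit e a i) * matrixUnit e a i = e := by
  have s := h.sq
  have ac : ∀ l m x, l ≠ m → a l * (a m * x) = -(a m * (a l * x)) := by
    intro l m x hlm
    rw [← mul_assoc, h.anticomm l m hlm, neg_mul, mul_assoc]
  have sx : ∀ l x, a l * (a l * x) = e * x := fun l x => by rw [← mul_assoc, s]
  have ex : ∀ l x, e * (a l * x) = a l * x := fun l x => by rw [← mul_assoc, h.e_mul_a]
  have iI : ∀ z : ℂ, Complex.I * (Complex.I * z) = -z := fun z => by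
    rw [← mul_assoc, Complex.I_mul_I, neg_one_mul]
  have iI' : ∀ z : ℂ, Complex.I * (z * Complex.I) = -z := fun z => by
    rw [mul_comm z, iI]
  have a10 := h.anticomm 1 0 (by decide)
  have a20 := h.anticomm 2 0 (by decide)
  have a30 := h.anticomm 3 0 (by decide)
  have a21 := h.anticomm 2 1 (by decide)
  have a31 := h.anticomm 3 1 (by decide)
  have a32 := h.anticomm 3 2 (by decide)
  have b10 := fun x => ac 1 0 x (by decide)
  have b20 := fun x => ac 2 0 x (by decide)
  have b30 := fun x => ac 3 0 x (by decide)
  have b21 := fun x => ac 2 1 x (by decide)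
  have b31 := fun x => ac 3 1 x (by decide)
  have b32 := fun x => ac 3 2 x (by decide)
  simp [matrixUnit, corner, Fin.sum_univ_four, mul_add, add_mul, mul_sub, sub_mul, mul_assoc,
    h.star_e, h.star_a,
    h.mul_e, h.e_mul_a, h.a_mul_e, s, sx, ex, a10, a20, a30, a21, a31, a32,
    b10, b20, b30, b21, b31, b32, smul_smul, smul_add, smul_sub,
    iI', neg_smul]
  match_scalars <;> (ring_nf; try norm_num [Complex.I_sq])

end CliffordSystem

theorem kronecker_one_mul_apply {m n k p : Type*} [Fintype m] [Fintype n] [Fintype k]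
    [DecidableEq k] (Z : Matrix m n ℂ) (N : Matrix (n × k) p ℂ) (i : m) (s : k) (b : p) :
    ((Z ⊗ₖ (1 : Matrix k k ℂ)) * N) (i, s) b = ∑ j, Z i j * N (j, s) b := by
  simp [Matrix.mul_apply, Fintype.sum_prod_type, Matrix.one_apply]

/-- Hermitian matrices that satisfy the Clifford relations on the range of `M`, and preserve it,
are there unitarily equivalent to `X l ⊗ 1`. -/
theorem exists_cliffordIsometry {d n : Type*} [Fintype d] [DecidableEq d] [Fintype n]
    (A : Fin 4 → Matrix d d ℂ) (hA : ∀ l, (A l)ᴴ = A l) (M : Matrix d n ℂ)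
    (C : Fin 4 → Matrix n n ℂ) (hC : ∀ l, A l * M = M * C l) (hsq : ∀ l, A l * (A l * M) = M)
    (hac : ∀ l m, l ≠ m → A l * (A m * M) = -(A m * (A l * M))) :
    ∃ (k : ℕ) (U : Matrix (Fin 4 × Fin k) d ℂ), Uᴴ * U = 1 ∧
      ∀ l, U * (A l * M) = (X l ⊗ₖ (1 : Matrix (Fin k) (Fin k) ℂ)) * (U * M) := by
  obtain ⟨Q, hQ, hQM⟩ := exists_rangeProjection M
  set e : Matrix d d ℂ := M * Q with he
  set a : Fin 4 → Matrix d d ℂ := fun l => A l * e with ha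
  have hee : e * e = e := by
    conv_lhs => rhs; rw [he]
    rw [← Matrix.mul_assoc, hQM]
  -- The range of `M` is invariant because `A l * M = M * C l`; taking adjoints, `e` commutes with
  -- the hermitian `A l`.
  have h1 : ∀ l, e * (A l * e) = A l * e := fun l => by
    have : A l * e = M * (C l * Q) := by rw [he, ← Matrix.mul_assoc, hC, Matrix.mul_assoc]
    rw [this, ← Matrix.mul_assoc, hQM]
  have h2 : ∀ l, e * A l = A l * e := fun l => by
    have := congrArg Matrix.conjTranspose (h1 l)
    simp only [Matrix.conjTranspose_mul, hQ, hA] at this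
    rw [← this, Matrix.mul_assoc, h1]
  have haa : ∀ l m, a l * a m = A l * (A m * e) := fun l m => by
    simp only [ha]
    rw [Matrix.mul_assoc, h1]
  have hcl : CliffordSystem e a :=
    { star_e := hQ
      mul_e := hee
      star_a := fun l => by
        simp only [ha, Matrix.star_eq_conjTranspose, Matrix.conjTranspose_mul, hQ, hA, h2]
      e_mul_a := h1
      a_mul_e := fun l => by simp only [ha, Matrix.mul_assoc, hee]
      sq := fun l => by
        rw [haa, he, ← Matrix.mul_assoc (A l) M, ← Matrix.mul_assoc, hsq]
      anticomm := fun l m hlm => by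
        rw [haa, haa, he, ← Matrix.mul_assoc (A m) M, ← Matrix.mul_assoc, hac l m hlm,
          Matrix.neg_mul]
        simp only [Matrix.mul_assoc] }
  set T := CliffordSystem.matrixUnit e a
  have hTM : ∀ i l, T i * (A l * M) = ∑ j, X l i j • (T j * M) := fun i l => by
    have : A l * M = a l * M := by simp only [ha, Matrix.mul_assoc, hQM]
    rw [this, ← Matrix.mul_assoc, hcl.matrixUnit_mul, Matrix.sum_mul]
    simp only [Matrix.smul_mul, T]
  have hR : (1 - e) * M = 0 := by rw [Matrix.sub_mul, Matrix.one_mul, hQM, sub_self]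
  have hRA : ∀ l, (1 - e) * (A l * M) = 0 := fun l => by
    rw [hC, ← Matrix.mul_assoc, hR, Matrix.zero_mul]
  let f : d ⊕ d ≃ Fin (Fintype.card (d ⊕ d)) := Fintype.equivFin _
  -- The first copy of `d` carries the bras `T i`. The second receives the orthogonal complement of
  -- the range, put at `i = 0`: this makes the map an isometry on all of `ℂ^d` and contributes
  -- nothing on `M`.
  let W : Fin 4 → d ⊕ d → d → ℂ := fun i s j =>
    Sum.elim (fun h => T i h j) (fun h => if i = 0 then (1 - e) h j else 0) s
  refine ⟨_, Matrix.of fun q j => W q.1 (f.symm q.2) j, ?_, fun l => ?_⟩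
  · have hsum : ∑ i, (T i)ᴴ * T i + (1 - e)ᴴ * (1 - e) = 1 := by
      have h3 : ∑ i, (T i)ᴴ * T i = e := hcl.sum_star_matrixUnit_mul
      rw [h3, Matrix.conjTranspose_sub, Matrix.conjTranspose_one, hQ]
      simp [mul_sub, sub_mul, hee]
    rw [← hsum]
    ext j j'
    simp only [Matrix.mul_apply, Matrix.add_apply, Matrix.sum_apply, Fintype.sum_prod_type,
      Matrix.conjTranspose_apply, Matrix.of_apply]
    have h4 : ∀ i, ∑ s, star (W i (f.symm s) j) * W i (f.symm s) j' =
        ∑ h, star (T i h j) * T i h j' +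
          if i = 0 then ∑ h, star ((1 - e) h j) * (1 - e) h j' else 0 := fun i => by
      rw [Equiv.sum_comp f.symm (fun s => star (W i s j) * W i s j'), Fintype.sum_sum_type]
      by_cases hi : i = 0 <;> simp [W, hi]
    simp only [h4, Finset.sum_add_distrib, Finset.sum_ite_eq', Finset.mem_univ, if_true]
  · have h5 : ∀ (N : Matrix d n ℂ) i s b,
        ((Matrix.of fun (q : Fin 4 × Fin (Fintype.card (d ⊕ d))) j => W q.1 (f.symm q.2) j) * N)
          (i, f s) b =
        Sum.elim (fun h => (T i * N) h b) (fun h => if i = 0 then ((1 - e) * N : Matrix d n ℂ) h b else 0) s := by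
      intro N i s b
      simp only [Matrix.mul_apply, Matrix.of_apply, Equiv.symm_apply_apply]
      rcases s with h | h
      · simp [W]
      · by_cases hi : i = 0 <;> simp [W, hi]
    ext ⟨i, s⟩ b
    obtain ⟨s, rfl⟩ := f.surjective s
    rw [kronecker_one_mul_apply]
    simp only [h5, hTM, hR, hRA]
    rcases s with h | h
    · simp [Matrix.sum_apply]
    · simp

/-- As `exists_cliffordIsometry`, with the transposed generators. -/
theorem exists_cliffordIsometry_transpose {d n : Type*} [Fintype d] [DecidableEq d] [Fintype n]
    (A : Fin 4 → Matrix d d ℂ) (hA : ∀ l, (A l)ᴴ = A l) (M : Matrix d n ℂ)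
    (C : Fin 4 → Matrix n n ℂ) (hC : ∀ l, A l * M = M * C l) (hsq : ∀ l, A l * (A l * M) = M)
    (hac : ∀ l m, l ≠ m → A l * (A m * M) = -(A m * (A l * M))) :
    ∃ (k : ℕ) (U : Matrix (Fin 4 × Fin k) d ℂ), Uᴴ * U = 1 ∧
      ∀ l, U * (A l * M) = ((X l)ᵀ ⊗ₖ (1 : Matrix (Fin k) (Fin k) ℂ)) * (U * M) := by
  obtain ⟨k, U, hU, h⟩ := exists_cliffordIsometry A hA M C hC hsq hac
  have hG : conjXᴴ * conjX = 1 := by rw [conjX_conjTranspose, neg_mul, conjX_sq, neg_neg]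
  refine ⟨k, (conjX ⊗ₖ (1 : Matrix (Fin k) (Fin k) ℂ)) * U, ?_, fun l => ?_⟩
  · rw [Matrix.conjTranspose_mul, Matrix.mul_assoc, ← Matrix.mul_assoc _ _ U,
      Matrix.conjTranspose_kronecker, ← Matrix.mul_kronecker_mul, hG]
    simp [hU]
  · rw [Matrix.mul_assoc, h, ← Matrix.mul_assoc, ← Matrix.mul_kronecker_mul, conjX_mul_X,
      Matrix.mul_assoc, ← Matrix.mul_assoc (_ ⊗ₖ _) (_ ⊗ₖ _), ← Matrix.mul_kronecker_mul]

/-! ### The Bell inequality -/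

theorem POVM.obs_conjTranspose {I A : Type*} [Fintype A] [DecidableEq A] (M : POVM I (Fin 2) A)
    (x : I) : (M.obs x)ᴴ = M.obs x := by
  rw [POVM.obs, Matrix.conjTranspose_sub, (M.pos x 0).isHermitian.eq, (M.pos x 1).isHermitian.eq]

theorem POVM.E_zero_add_E_one {I A : Type*} [Fintype A] [DecidableEq A] (M : POVM I (Fin 2) A)
    (x : I) : M.E x 0 + M.E x 1 = 1 := by
  rw [← M.sum_eq_one x, Fin.sum_univ_two]

theorem POVM.E_eq_obs {I A : Type*} [Fintype A] [DecidableEq A] (M : POVM I (Fin 2) A)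
    (x : I) (a : Fin 2) : M.E x a = (1 / 2 : ℂ) • (1 + (-1 : ℂ) ^ (a : ℕ) • M.obs x) := by
  rw [← M.E_zero_add_E_one x, POVM.obs]
  fin_cases a
  · simp only [Fin.zero_eta, pow_zero]
    module
  · simp only [Fin.mk_one, pow_one]
    module

/-- With `F = 1 - E`, the difference is `4EF = 4(EFE + FEF)`, since `E` and `F` commute and add up
to one. -/
theorem POVM.one_sub_obs_sq_posSemidef {I A : Type*} [Fintype A] [DecidableEq A]
    (M : POVM I (Fin 2) A) (x : I) : (1 - M.obs x * M.obs x).PosSemidef := by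
  set E := M.E x 0
  set F := M.E x 1
  have hF : F = 1 - E := eq_sub_of_add_eq' (M.E_zero_add_E_one x)
  have h : 1 - M.obs x * M.obs x =
      (4 : ℝ) • (E * F * Eᴴ + F * E * Fᴴ) := by
    rw [(M.pos x 0).isHermitian.eq, (M.pos x 1).isHermitian.eq]
    change 1 - (E - F) * (E - F) = (4 : ℝ) • (E * F * E + F * E * F)
    rw [hF]
    simp only [mul_sub, sub_mul, mul_one, one_mul, mul_assoc]
    module
  rw [h]
  exact (((M.pos x 1).mul_mul_conjTranspose_same E).add
    ((M.pos x 0).mul_mul_conjTranspose_same F)).smul (by norm_num)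

theorem mulVec_eq_zero_of_add {n : Type*} [Fintype n] {P Q : Matrix n n ℂ}
    (hP : P.PosSemidef) (hQ : Q.PosSemidef) {v : n → ℂ} (h : (P + Q) *ᵥ v = 0) :
    P *ᵥ v = 0 ∧ Q *ᵥ v = 0 := by
  have h0 : star v ⬝ᵥ P *ᵥ v + star v ⬝ᵥ Q *ᵥ v = 0 := by
    rw [← dotProduct_add, ← Matrix.add_mulVec, h, dotProduct_zero]
  have h1 := hP.dotProduct_mulVec_nonneg v
  have h2 := hQ.dotProduct_mulVec_nonneg v
  obtain ⟨h3, h4⟩ := (add_eq_zero_iff_of_nonneg h1 h2).mp h0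
  exact ⟨(hP.dotProduct_mulVec_zero_iff v).mp h3, (hQ.dotProduct_mulVec_zero_iff v).mp h4⟩

/-- `1 / √2` as a complex number. -/
def rsqrt2 : ℂ := ((1 / √2 : ℝ) : ℂ)

theorem rsqrt2_mul_self : rsqrt2 * rsqrt2 = 1 / 2 := by
  rw [rsqrt2, ← Complex.ofReal_mul, div_mul_div_comm, Real.mul_self_sqrt (by norm_num)]
  norm_num

theorem rsqrt2_ne_zero : rsqrt2 ≠ 0 := fun h => by
  have := rsqrt2_mul_self
  rw [h] at this
  norm_num at this

theorem star_rsqrt2 : star rsqrt2 = rsqrt2 := Complex.conj_ofReal _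

theorem ofReal_sqrt_two : ((√2 : ℝ) : ℂ) = 2 * rsqrt2 := by
  rw [rsqrt2, one_div, ← Complex.ofReal_ofNat, ← Complex.ofReal_mul]
  congr 1
  field_simp
  norm_num

/-! ### A sum-of-squares certificate for CHSH. -/

section CHSH

variable {A B : Type*} [Fintype A] [DecidableEq A] [Fintype B] [DecidableEq B]

/-- The operator `A ⊗ 1 - 1 ⊗ B`. -/
def diffOp (P : Matrix A A ℂ) (Q : Matrix B B ℂ) : Matrix (A × B) (A × B) ℂ :=
  P ⊗ₖ (1 : Matrix B B ℂ) - (1 : Matrix A A ℂ) ⊗ₖ Q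

theorem diffOp_conjTranspose {P : Matrix A A ℂ} {Q : Matrix B B ℂ} (hP : Pᴴ = P) (hQ : Qᴴ = Q) :
    (diffOp P Q)ᴴ = diffOp P Q := by
  simp [diffOp, Matrix.conjTranspose_sub, Matrix.conjTranspose_kronecker, hP, hQ]

/-- The two squares add up to `A₁² + A₂² + B₁² + B₂² - √2 CHSH`; the four defects replace the
squared observables by `4`. The constant `4 * rsqrt2` is `2√2`. -/
theorem chsh_sumOfSquares (A₁ A₂ : Matrix A A ℂ) (B₁ B₂ : Matrix B B ℂ) :
    (4 * rsqrt2) • (1 : Matrix (A × B) (A × B) ℂ) - chshOp A₁ A₂ B₁ B₂ =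
      rsqrt2 • (diffOp (rsqrt2 • (A₁ + A₂)) B₁ * diffOp (rsqrt2 • (A₁ + A₂)) B₁ +
        (diffOp (rsqrt2 • (A₁ - A₂)) B₂ * diffOp (rsqrt2 • (A₁ - A₂)) B₂ +
        ((1 - A₁ * A₁) ⊗ₖ (1 : Matrix B B ℂ) + ((1 - A₂ * A₂) ⊗ₖ (1 : Matrix B B ℂ) +
        ((1 : Matrix A A ℂ) ⊗ₖ (1 - B₁ * B₁) + (1 : Matrix A A ℂ) ⊗ₖ (1 - B₂ * B₂)))))) := by
  have hr := rsqrt2_mul_self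
  have e1 : ∀ P Q : Matrix A A ℂ, (P - Q) ⊗ₖ (1 : Matrix B B ℂ) = P ⊗ₖ 1 - Q ⊗ₖ 1 :=
    fun P Q => by ext; simp [Matrix.kroneckerMap_apply, sub_mul]
  have e2 : ∀ P Q : Matrix B B ℂ, (1 : Matrix A A ℂ) ⊗ₖ (P - Q) = 1 ⊗ₖ P - 1 ⊗ₖ Q :=
    fun P Q => by ext; simp [Matrix.kroneckerMap_apply, mul_sub]
  have e3 : ∀ (P Q : Matrix A A ℂ) (R : Matrix B B ℂ), (P - Q) ⊗ₖ R = P ⊗ₖ R - Q ⊗ₖ R :=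
    fun P Q R => by ext; simp [Matrix.kroneckerMap_apply, sub_mul]
  simp only [diffOp, chshOp, Matrix.smul_kronecker, Matrix.add_kronecker, e1, e2, e3, mul_sub,
    sub_mul, ← Matrix.mul_kronecker_mul, one_mul, mul_one, smul_mul_assoc, mul_smul_comm, add_mul,
    mul_add, Matrix.one_kronecker_one]
  match_scalars <;> grind

theorem rsqrt2_nonneg : 0 ≤ rsqrt2 := by
  rw [rsqrt2, Complex.zero_le_real]
  positivity

variable {A₁ A₂ : Matrix A A ℂ} {B₁ B₂ : Matrix B B ℂ}

theorem diffOp_sq_posSemidef {P : Matrix A A ℂ} {Q : Matrix B B ℂ} (hP : Pᴴ = P) (hQ : Qᴴ = Q) :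
    (diffOp P Q * diffOp P Q).PosSemidef := by
  conv => arg 1; lhs; rw [← diffOp_conjTranspose hP hQ]
  exact Matrix.posSemidef_conjTranspose_mul_self _

theorem chsh_gap_posSemidef (hA₁ : A₁ᴴ = A₁) (hA₂ : A₂ᴴ = A₂) (hB₁ : B₁ᴴ = B₁) (hB₂ : B₂ᴴ = B₂)
    (pA₁ : (1 - A₁ * A₁).PosSemidef) (pA₂ : (1 - A₂ * A₂).PosSemidef)
    (pB₁ : (1 - B₁ * B₁).PosSemidef) (pB₂ : (1 - B₂ * B₂).PosSemidef) :
    ((4 * rsqrt2) • (1 : Matrix (A × B) (A × B) ℂ) - chshOp A₁ A₂ B₁ B₂).PosSemidef := by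
  rw [chsh_sumOfSquares]
  refine ((diffOp_sq_posSemidef ?_ hB₁).add ((diffOp_sq_posSemidef ?_ hB₂).add
    ((pA₁.kronecker .one).add ((pA₂.kronecker .one).add
    ((Matrix.PosSemidef.one.kronecker pB₁).add (Matrix.PosSemidef.one.kronecker pB₂)))))).smul
    rsqrt2_nonneg
  · simp [Matrix.conjTranspose_smul, star_rsqrt2, hA₁, hA₂]
  · simp [Matrix.conjTranspose_smul, star_rsqrt2, hA₁, hA₂]

/-- All six terms of the certificate are positive semidefinite, so a vector killed by their sum is
killed by each. -/
theorem chsh_gap_mulVec_eq_zero (hA₁ : A₁ᴴ = A₁) (hA₂ : A₂ᴴ = A₂) (hB₁ : B₁ᴴ = B₁)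
    (hB₂ : B₂ᴴ = B₂)
    (pA₁ : (1 - A₁ * A₁).PosSemidef) (pA₂ : (1 - A₂ * A₂).PosSemidef)
    (pB₁ : (1 - B₁ * B₁).PosSemidef) (pB₂ : (1 - B₂ * B₂).PosSemidef) {v : A × B → ℂ}
    (hv : ((4 * rsqrt2) • (1 : Matrix (A × B) (A × B) ℂ) - chshOp A₁ A₂ B₁ B₂) *ᵥ v = 0) :
    diffOp (rsqrt2 • (A₁ + A₂)) B₁ *ᵥ v = 0 ∧ diffOp (rsqrt2 • (A₁ - A₂)) B₂ *ᵥ v = 0 ∧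
    ((1 - A₁ * A₁) ⊗ₖ (1 : Matrix B B ℂ)) *ᵥ v = 0 ∧
    ((1 - A₂ * A₂) ⊗ₖ (1 : Matrix B B ℂ)) *ᵥ v = 0 ∧
    ((1 : Matrix A A ℂ) ⊗ₖ (1 - B₁ * B₁)) *ᵥ v = 0 ∧
    ((1 : Matrix A A ℂ) ⊗ₖ (1 - B₂ * B₂)) *ᵥ v = 0 := by
  rw [chsh_sumOfSquares, Matrix.smul_mulVec] at hv
  have hv := (smul_eq_zero.mp hv).resolve_left rsqrt2_ne_zero
  have h1 : (rsqrt2 • (A₁ + A₂))ᴴ = rsqrt2 • (A₁ + A₂) := by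
    simp [Matrix.conjTranspose_smul, star_rsqrt2, hA₁, hA₂]
  have h2 : (rsqrt2 • (A₁ - A₂))ᴴ = rsqrt2 • (A₁ - A₂) := by
    simp [Matrix.conjTranspose_smul, star_rsqrt2, hA₁, hA₂]
  have p1 := diffOp_sq_posSemidef h1 hB₁
  have p2 := diffOp_sq_posSemidef h2 hB₂
  have p3 := pA₁.kronecker (Matrix.PosSemidef.one (n := B) (R := ℂ))
  have p4 := pA₂.kronecker (Matrix.PosSemidef.one (n := B) (R := ℂ))
  have p5 := (Matrix.PosSemidef.one (n := A) (R := ℂ)).kronecker pB₁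
  have p6 := (Matrix.PosSemidef.one (n := A) (R := ℂ)).kronecker pB₂
  obtain ⟨k1, hv⟩ := mulVec_eq_zero_of_add p1 (p2.add (p3.add (p4.add (p5.add p6)))) hv
  obtain ⟨k2, hv⟩ := mulVec_eq_zero_of_add p2 (p3.add (p4.add (p5.add p6))) hv
  obtain ⟨k3, hv⟩ := mulVec_eq_zero_of_add p3 (p4.add (p5.add p6)) hv
  obtain ⟨k4, hv⟩ := mulVec_eq_zero_of_add p4 (p5.add p6) hv
  obtain ⟨k5, k6⟩ := mulVec_eq_zero_of_add p5 p6 hv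
  refine ⟨?_, ?_, k3, k4, k5, k6⟩
  · conv at k1 => lhs; arg 1; lhs; rw [← diffOp_conjTranspose h1 hB₁]
    exact (Matrix.conjTranspose_mul_self_mulVec_eq_zero _ _).mp k1
  · conv at k2 => lhs; arg 1; lhs; rw [← diffOp_conjTranspose h2 hB₂]
    exact (Matrix.conjTranspose_mul_self_mulVec_eq_zero _ _).mp k2

end CHSH

/-! ### The six CHSH gaps together. -/

section Bell

variable {A B : Type*} [Fintype A] [DecidableEq A] [Fintype B] [DecidableEq B]
  (M : POVM (Fin 4) (Fin 2) A) (N : POVM BobInput (Fin 2) B)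

/-- The operator `2√2 - CHSH` for the pair `p`. -/
def bellGap (p : Pair) : Matrix (A × B) (A × B) ℂ :=
  (4 * rsqrt2) • (1 : Matrix (A × B) (A × B) ℂ) -
    chshOp (M.obs p.1.1) (M.obs p.1.2) (N.obs (p, 0)) (N.obs (p, 1))

theorem bellGap_posSemidef (p : Pair) : (bellGap M N p).PosSemidef :=
  chsh_gap_posSemidef (M.obs_conjTranspose _) (M.obs_conjTranspose _) (N.obs_conjTranspose _)
    (N.obs_conjTranspose _) (M.one_sub_obs_sq_posSemidef _) (M.one_sub_obs_sq_posSemidef _)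
    (N.one_sub_obs_sq_posSemidef _) (N.one_sub_obs_sq_posSemidef _)

theorem sum_bellGap :
    ∑ p, bellGap M N p =
      ((12 * √2 : ℝ) : ℂ) • (1 : Matrix (A × B) (A × B) ℂ) - bellOp M N := by
  have hc : Fintype.card Pair = 6 := by decide
  simp only [bellGap, Finset.sum_sub_distrib, Finset.sum_const, Finset.card_univ, hc, bellOp]
  congr 1
  rw [Complex.ofReal_mul, ofReal_sqrt_two, ← Nat.cast_smul_eq_nsmul ℂ, smul_smul]
  congr 1
  push_cast
  ring

variable {P : Type*} [Fintype P] {ψ : P → A × B → ℂ}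

/-- The family `ψ p` stands for the components of a purification along a basis of the purifying
space; a pure state is the case of a one-point index. -/
theorem sum_re_bellGap (h1 : ∑ p, star (ψ p) ⬝ᵥ ψ p = 1) :
    ∑ q, ∑ p, (star (ψ p) ⬝ᵥ bellGap M N q *ᵥ ψ p).re =
      12 * √2 - (∑ p, star (ψ p) ⬝ᵥ bellOp M N *ᵥ ψ p).re := by
  have h : ∑ q, ∑ p, star (ψ p) ⬝ᵥ bellGap M N q *ᵥ ψ p =
      ((12 * √2 : ℝ) : ℂ) - ∑ p, star (ψ p) ⬝ᵥ bellOp M N *ᵥ ψ p := by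
    rw [Finset.sum_comm]
    simp only [← dotProduct_sum, ← Matrix.sum_mulVec, sum_bellGap, Matrix.sub_mulVec,
      Matrix.smul_mulVec, Matrix.one_mulVec, dotProduct_sub, dotProduct_smul,
      Finset.sum_sub_distrib, smul_eq_mul, ← Finset.mul_sum, h1, mul_one]
  have h' := congrArg Complex.re h
  simpa only [Complex.re_sum, Complex.sub_re, Complex.ofReal_re] using h'

theorem re_bellOp_le (h1 : ∑ p, star (ψ p) ⬝ᵥ ψ p = 1) :
    (∑ p, star (ψ p) ⬝ᵥ bellOp M N *ᵥ ψ p).re ≤ 12 * √2 := by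
  rw [← sub_nonneg, ← sum_re_bellGap M N h1]
  exact Finset.sum_nonneg fun q _ => Finset.sum_nonneg fun p _ =>
    (bellGap_posSemidef M N q).re_dotProduct_nonneg (ψ p)

/-- The nonnegative expectations of the gaps, over all pairs and all components, add up to zero, so
each vanishes; a positive semidefinite operator with zero expectation annihilates the vector. -/
theorem bellGap_mulVec_eq_zero (h1 : ∑ p, star (ψ p) ⬝ᵥ ψ p = 1)
    (h2 : (∑ p, star (ψ p) ⬝ᵥ bellOp M N *ᵥ ψ p).re = 12 * √2) (q : Pair) (p : P) :
    bellGap M N q *ᵥ ψ p = 0 := by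
  have hn : ∀ q p, 0 ≤ (star (ψ p) ⬝ᵥ bellGap M N q *ᵥ ψ p).re := fun q p =>
    (bellGap_posSemidef M N q).re_dotProduct_nonneg (ψ p)
  have h := sum_re_bellGap M N h1
  rw [h2, sub_self, Finset.sum_eq_zero_iff_of_nonneg
    fun q _ => Finset.sum_nonneg fun p _ => hn q p] at h
  have h3 := h q (Finset.mem_univ _)
  rw [Finset.sum_eq_zero_iff_of_nonneg fun p _ => hn q p] at h3
  have h4 := h3 p (Finset.mem_univ _)
  rw [← (bellGap_posSemidef M N q).dotProduct_mulVec_zero_iff]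
  have h5 := (bellGap_posSemidef M N q).dotProduct_mulVec_nonneg (ψ p)
  exact Complex.ext h4 (Complex.le_def.mp h5).2.symm

end Bell

/-! ### The self-test -/

/-! ### Bipartite vectors as matrices. -/

section Mat

variable {A B A' B' P : Type*}

/-- A vector of `ℂ^A ⊗ ℂ^B` as a matrix. -/
def mat (v : A × B → ℂ) : Matrix A B ℂ :=
  Matrix.of fun a b => v (a, b)

theorem mat_injective : Function.Injective (mat : (A × B → ℂ) → Matrix A B ℂ) := fun v w h => by
  funext q
  exact congrFun (congrFun h q.1) q.2

/-- Alice's operators become left multiplications, Bob's become right multiplications by transposes.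
-/
theorem mat_kronecker_mulVec [Fintype A] [Fintype B] (Z : Matrix A' A ℂ) (W : Matrix B' B ℂ)
    (v : A × B → ℂ) : mat ((Z ⊗ₖ W) *ᵥ v) = Z * mat v * Wᵀ := by
  ext i j
  simp only [mat, Matrix.of_apply, Matrix.mulVec, dotProduct, Matrix.kroneckerMap_apply,
    Matrix.mul_apply, Matrix.transpose_apply, Fintype.sum_prod_type, Finset.sum_mul]
  rw [Finset.sum_comm]
  exact Finset.sum_congr rfl fun b _ => Finset.sum_congr rfl fun a _ => by ring

theorem mat_tensorState (v : A × B → ℂ) (aux : A' × B' → ℂ) :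
    mat (tensorState v aux) = mat v ⊗ₖ mat aux := rfl

theorem mat_φ₄ : mat φ₄ = (1 / 2 : ℂ) • (1 : Matrix (Fin 4) (Fin 4) ℂ) := by
  ext i j
  by_cases h : i = j <;> simp [mat, φ₄, h]

theorem mul_mat_eq_of_diffOp [Fintype A] [DecidableEq A] [Fintype B] [DecidableEq B]
    {Z : Matrix A A ℂ} {W : Matrix B B ℂ} {v : A × B → ℂ} :
    diffOp Z W *ᵥ v = 0 ↔ Z * mat v = mat v * Wᵀ := by
  rw [diffOp, Matrix.sub_mulVec, sub_eq_zero, ← mat_injective.eq_iff, mat_kronecker_mulVec,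
    mat_kronecker_mulVec, Matrix.transpose_one, Matrix.mul_one, Matrix.one_mul]

theorem dotProduct_tensorState [Fintype A] [Fintype B] [Fintype A'] [Fintype B']
    (v : A × B → ℂ) (aux : A' × B' → ℂ) :
    star (tensorState v aux) ⬝ᵥ tensorState v aux = (star v ⬝ᵥ v) * (star aux ⬝ᵥ aux) := by
  simp only [dotProduct, Fintype.sum_mul_sum, ← Fintype.sum_prod_type']
  refine Fintype.sum_equiv (Equiv.prodProdProdComm A A' B B') _ _ fun q => ?_
  simp only [tensorState, Pi.star_apply, star_mul', Equiv.prodProdProdComm_apply]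
  ring

/-- The matrices `F p`, side by side. -/
def sideBySide (F : P → Matrix A B ℂ) : Matrix A (B × P) ℂ :=
  Matrix.of fun a q => F q.2 a q.1

theorem sideBySide_injective :
    Function.Injective (sideBySide : (P → Matrix A B ℂ) → Matrix A (B × P) ℂ) := fun F G h => by
  funext p
  ext a b
  exact congrFun (congrFun h a) (b, p)

theorem mul_sideBySide [Fintype A] (Z : Matrix A' A ℂ) (F : P → Matrix A B ℂ) :
    Z * sideBySide F = sideBySide fun p => Z * F p := rfl

theorem sideBySide_mul [Fintype B] [Fintype P] [DecidableEq P] (F : P → Matrix A B ℂ)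
    (W : Matrix B B' ℂ) :
    sideBySide F * (W ⊗ₖ (1 : Matrix P P ℂ)) = sideBySide fun p => F p * W := by
  ext a ⟨b, p⟩
  simp [sideBySide, Matrix.mul_apply, Fintype.sum_prod_type, Matrix.one_apply]

end Mat

/-- A single isometry must work for every component. With the components side by side, the range is
their joint local support, and the single-matrix result applies there. -/
theorem exists_cliffordIsometry_family {A B P : Type*} [Fintype A] [DecidableEq A] [Fintype B]
    [Fintype P] [DecidableEq P] (O : Fin 4 → Matrix A A ℂ) (hO : ∀ l, (O l)ᴴ = O l)
    (F : P → Matrix A B ℂ) (C : Fin 4 → Matrix B B ℂ) (hC : ∀ l p, O l * F p = F p * C l)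
    (hsq : ∀ l p, O l * (O l * F p) = F p)
    (hac : ∀ l m, l ≠ m → ∀ p, O l * (O m * F p) = -(O m * (O l * F p))) :
    (∃ (k : ℕ) (U : Matrix (Fin 4 × Fin k) A ℂ), Uᴴ * U = 1 ∧
      ∀ l p, U * (O l * F p) = (X l ⊗ₖ (1 : Matrix (Fin k) (Fin k) ℂ)) * (U * F p)) ∧
    (∃ (k : ℕ) (U : Matrix (Fin 4 × Fin k) A ℂ), Uᴴ * U = 1 ∧
      ∀ l p, U * (O l * F p) = ((X l)ᵀ ⊗ₖ (1 : Matrix (Fin k) (Fin k) ℂ)) * (U * F p)) := by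
  have h1 : ∀ l, O l * sideBySide F = sideBySide F * (C l ⊗ₖ (1 : Matrix P P ℂ)) := fun l => by
    simp only [mul_sideBySide, sideBySide_mul, hC]
  have h2 : ∀ l, O l * (O l * sideBySide F) = sideBySide F := fun l => by
    simp only [mul_sideBySide, hsq]
  have h3 : ∀ l m, l ≠ m →
      O l * (O m * sideBySide F) = -(O m * (O l * sideBySide F)) := fun l m hlm => by
    simp only [mul_sideBySide, hac l m hlm]
    rfl
  constructor
  · obtain ⟨k, U, hU, h⟩ := exists_cliffordIsometry O hO _ _ h1 h2 h3
    refine ⟨k, U, hU, fun l p => ?_⟩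
    have := h l
    simp only [mul_sideBySide] at this
    exact congrFun (sideBySide_injective this) p
  · obtain ⟨k, U, hU, h⟩ := exists_cliffordIsometry_transpose O hO _ _ h1 h2 h3
    refine ⟨k, U, hU, fun l p => ?_⟩
    have := h l
    simp only [mul_sideBySide] at this
    exact congrFun (sideBySide_injective this) p

/-- A matrix that intertwines the `X l ⊗ 1` is of the form `1 ⊗ c`. -/
theorem eq_one_kronecker_of_intertwines {k k' : Type*} [Fintype k] [DecidableEq k] [Fintype k']
    [DecidableEq k'] (N : Matrix (Fin 4 × k) (Fin 4 × k') ℂ)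
    (h : ∀ l, (X l ⊗ₖ (1 : Matrix k k ℂ)) * N = N * (X l ⊗ₖ (1 : Matrix k' k' ℂ))) :
    N = (1 : Matrix (Fin 4) (Fin 4) ℂ) ⊗ₖ (Matrix.of fun s t => N (0, s) (0, t)) := by
  ext ⟨i, s⟩ ⟨j, t⟩
  have h1 := eq_smul_one_of_commute_X (Matrix.of fun i j => N (i, s) (j, t)) (fun l => by
    ext i j
    have h2 := congrFun (congrFun (h l) (i, s)) (j, t)
    rw [kronecker_one_mul_apply] at h2
    simpa [Matrix.mul_apply, Fintype.sum_prod_type, Matrix.one_apply] using h2)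
  have h3 := congrFun (congrFun h1 i) j
  simpa [Matrix.one_apply] using h3

/-! ### From maximal violation to the local isometries. -/

section Relations

variable {A B P : Type*} [Fintype A] [DecidableEq A] [Fintype B] [DecidableEq B]
  (M : POVM (Fin 4) (Fin 2) A) (N : POVM BobInput (Fin 2) B)

/-- Anticommutation comes from Bob: his observable `(q, 0)` acts on the state as `(A₁ + A₂)/√2` and
squares to one there, so `(A₁ + A₂)²/2` acts as the identity. Since `A₁²` and `A₂²` also do, the
anticommutator vanishes on the state. -/
theorem mat_relations_of_bellGap (q : Pair) {v : A × B → ℂ} (hv : bellGap M N q *ᵥ v = 0) :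
    (∀ s : Fin 2, mat v * (N.obs (q, s))ᵀ =
      rsqrt2 • ((M.obs q.1.1 + (-1 : ℂ) ^ (s : ℕ) • M.obs q.1.2) * mat v)) ∧
    M.obs q.1.1 * (M.obs q.1.1 * mat v) = mat v ∧ M.obs q.1.2 * (M.obs q.1.2 * mat v) = mat v ∧
    M.obs q.1.1 * (M.obs q.1.2 * mat v) = -(M.obs q.1.2 * (M.obs q.1.1 * mat v)) := by
  obtain ⟨k1, k2, k3, k4, k5, -⟩ := chsh_gap_mulVec_eq_zero (M.obs_conjTranspose _)
    (M.obs_conjTranspose _) (N.obs_conjTranspose _) (N.obs_conjTranspose _)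
    (M.one_sub_obs_sq_posSemidef _) (M.one_sub_obs_sq_posSemidef _)
    (N.one_sub_obs_sq_posSemidef _) (N.one_sub_obs_sq_posSemidef _) hv
  rw [mul_mat_eq_of_diffOp] at k1 k2
  have z : mat (0 : A × B → ℂ) = 0 := rfl
  have k3' := congrArg mat k3
  have k4' := congrArg mat k4
  have k5' := congrArg mat k5
  simp only [mat_kronecker_mulVec, z, Matrix.transpose_one, Matrix.mul_one, Matrix.one_mul,
    Matrix.sub_mul, sub_eq_zero, Matrix.transpose_sub, Matrix.mul_sub, Matrix.transpose_mul,
    Matrix.mul_assoc] at k3' k4' k5'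
  refine ⟨fun s => ?_, k3'.symm, k4'.symm, ?_⟩
  · fin_cases s
    · simp [← k1, Matrix.add_mul]
    · simp [← k2, sub_eq_add_neg, Matrix.add_mul]
  · rw [← Matrix.mul_assoc (mat v), ← k1, Matrix.mul_assoc, ← k1] at k5'
    simp only [Matrix.smul_mul, Matrix.mul_smul, Matrix.add_mul, Matrix.mul_add, ← k3',
      ← k4'] at k5'
    rw [← smul_add, smul_smul, rsqrt2_mul_self] at k5'
    rw [eq_neg_iff_add_eq_zero]
    have h := congrArg (fun T => (2 : ℂ) • T - (2 : ℂ) • mat v) k5'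
    simp only [sub_self] at h
    refine Eq.trans ?_ h.symm
    module

/-- Bob has hermitian matrices whose action on the state agrees with that of Alice's observables. -/
theorem exists_bob_obs {ψ : P → A × B → ℂ} (hψ : ∀ q p, bellGap M N q *ᵥ ψ p = 0) (l : Fin 4) :
    ∃ D : Matrix B B ℂ, Dᴴ = D ∧ ∀ p, M.obs l * mat (ψ p) = mat (ψ p) * Dᵀ := by
  have hr := rsqrt2_mul_self
  have key : ∀ q : Pair,
      (∃ D : Matrix B B ℂ, Dᴴ = D ∧ ∀ p, M.obs q.1.1 * mat (ψ p) = mat (ψ p) * Dᵀ) ∧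
      (∃ D : Matrix B B ℂ, Dᴴ = D ∧ ∀ p, M.obs q.1.2 * mat (ψ p) = mat (ψ p) * Dᵀ) := by
    intro q
    -- Bob's two observables act as `(A₁ ± A₂)/√2`, so their normalized sum and difference act as
    -- `A₁` and `A₂`. These need not be observables, but they are hermitian.
    refine ⟨⟨rsqrt2 • (N.obs (q, 0) + N.obs (q, 1)), ?_, fun p => ?_⟩,
      ⟨rsqrt2 • (N.obs (q, 0) - N.obs (q, 1)), ?_, fun p => ?_⟩⟩
    · simp [Matrix.conjTranspose_smul, star_rsqrt2, N.obs_conjTranspose]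
    · have h := (mat_relations_of_bellGap M N q (hψ q p)).1
      simp only [Matrix.transpose_smul, Matrix.transpose_add, Matrix.mul_smul, Matrix.mul_add, h]
      simp [Matrix.add_mul]
      match_scalars
      all_goals grind
    · simp [Matrix.conjTranspose_smul, star_rsqrt2, N.obs_conjTranspose]
    · have h := (mat_relations_of_bellGap M N q (hψ q p)).1
      simp only [Matrix.transpose_smul, Matrix.transpose_sub, Matrix.mul_smul, Matrix.mul_sub, h]
      simp [Matrix.add_mul]
      match_scalars
      all_goals grind
  -- The disjoint pairs `(0, 1)` and `(2, 3)` already cover all four inputs.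
  fin_cases l
  · exact (key ⟨(0, 1), by decide⟩).1
  · exact (key ⟨(0, 1), by decide⟩).2
  · exact (key ⟨(2, 3), by decide⟩).1
  · exact (key ⟨(2, 3), by decide⟩).2

theorem alice_obs_sq {ψ : P → A × B → ℂ} (hψ : ∀ q p, bellGap M N q *ᵥ ψ p = 0) (l : Fin 4)
    (p : P) : M.obs l * (M.obs l * mat (ψ p)) = mat (ψ p) := by
  have key := fun q => (mat_relations_of_bellGap M N q (hψ q p)).2
  fin_cases l
  · exact (key ⟨(0, 1), by decide⟩).1
  · exact (key ⟨(0, 1), by decide⟩).2.1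
  · exact (key ⟨(2, 3), by decide⟩).1
  · exact (key ⟨(2, 3), by decide⟩).2.1

theorem alice_obs_anticomm {ψ : P → A × B → ℂ} (hψ : ∀ q p, bellGap M N q *ᵥ ψ p = 0)
    (l m : Fin 4) (hlm : l ≠ m) (p : P) :
    M.obs l * (M.obs m * mat (ψ p)) = -(M.obs m * (M.obs l * mat (ψ p))) := by
  rcases lt_or_gt_of_ne hlm with h | h
  · exact (mat_relations_of_bellGap M N ⟨(l, m), h⟩ (hψ _ p)).2.2.2
  · rw [(mat_relations_of_bellGap M N ⟨(m, l), h⟩ (hψ _ p)).2.2.2, neg_neg]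

theorem Y_transpose (y : BobInput) :
    (Y y)ᵀ = rsqrt2 • (X y.1.1.1 + (-1 : ℂ) ^ (y.2 : ℕ) • X y.1.1.2) := by
  rw [Y, Matrix.transpose_smul, Matrix.transpose_transpose]
  rfl

/-- The self-test for a family of vectors, the components of a state shared with a third party. -/
theorem exists_dilation [Fintype P] {ψ : P → A × B → ℂ}
    (h1 : ∑ p, star (ψ p) ⬝ᵥ ψ p = 1)
    (h2 : (∑ p, star (ψ p) ⬝ᵥ bellOp M N *ᵥ ψ p).re = 12 * √2) :
    ∃ (kA kB : ℕ) (UA : Matrix (Fin 4 × Fin kA) A ℂ) (UB : Matrix (Fin 4 × Fin kB) B ℂ)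
      (aux : P → Fin kA × Fin kB → ℂ),
      UAᴴ * UA = 1 ∧ UBᴴ * UB = 1 ∧ ∑ p, star (aux p) ⬝ᵥ aux p = 1 ∧
      ∀ p, (UA ⊗ₖ UB) *ᵥ ψ p = tensorState φ₄ (aux p) ∧
      (∀ x a, (UA ⊗ₖ UB) *ᵥ ((M.E x a ⊗ₖ (1 : Matrix B B ℂ)) *ᵥ ψ p) =
        tensorState ((quatStrategy.alice.E x a ⊗ₖ (1 : Matrix (Fin 4) (Fin 4) ℂ)) *ᵥ φ₄)
          (aux p)) ∧
      (∀ y b, (UA ⊗ₖ UB) *ᵥ (((1 : Matrix A A ℂ) ⊗ₖ N.E y b) *ᵥ ψ p) =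
        tensorState (((1 : Matrix (Fin 4) (Fin 4) ℂ) ⊗ₖ quatStrategy.bob.E y b) *ᵥ φ₄)
          (aux p)) := by
  classical
  have hψ := bellGap_mulVec_eq_zero M N h1 h2
  choose D hD hAD using exists_bob_obs M N hψ
  have hsq := alice_obs_sq M N hψ
  have hac := alice_obs_anticomm M N hψ
  have hDA : ∀ l p, D l * (mat (ψ p))ᵀ = (mat (ψ p))ᵀ * (M.obs l)ᵀ := fun l p => by
    rw [← Matrix.transpose_mul, hAD, Matrix.transpose_mul, Matrix.transpose_transpose]
  have hDD : ∀ l m p, D l * (D m * (mat (ψ p))ᵀ) = (M.obs m * (M.obs l * mat (ψ p)))ᵀ :=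
    fun l m p => by
      rw [hDA, ← Matrix.mul_assoc, hDA]
      simp only [Matrix.transpose_mul]
  obtain ⟨kA, UA, hUA, hXA⟩ := (exists_cliffordIsometry_family M.obs M.obs_conjTranspose
    (fun p => mat (ψ p)) (fun l => (D l)ᵀ) hAD hsq hac).1
  -- Bob's matrices act through their transposes, so the transposed model is chosen on his side;
  -- this matches `X l ⊗ 1` and `1 ⊗ (X l)ᵀ`, which agree on `φ₄`.
  obtain ⟨kB, UB, hUB, hXB⟩ := (exists_cliffordIsometry_family D hD
    (fun p => (mat (ψ p))ᵀ) (fun l => (M.obs l)ᵀ) hDA (fun l p => by rw [hDD, hsq])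
    (fun l m hlm p => by rw [hDD, hDD, hac m l hlm.symm, Matrix.transpose_neg])).2
  have hχX : ∀ l p, UA * (M.obs l * mat (ψ p)) * UBᵀ =
      (X l ⊗ₖ (1 : Matrix (Fin kA) (Fin kA) ℂ)) * (UA * mat (ψ p) * UBᵀ) := fun l p => by
    rw [hXA]
    simp only [Matrix.mul_assoc]
  -- Moving an observable from Alice's side to Bob's shows that the transformed state intertwines `X
  -- l ⊗ 1` with itself.
  have hχ : ∀ p, ∃ c : Matrix (Fin kA) (Fin kB) ℂ,
      UA * mat (ψ p) * UBᵀ = (1 : Matrix (Fin 4) (Fin 4) ℂ) ⊗ₖ c := fun p => by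
    refine ⟨_, eq_one_kronecker_of_intertwines _ fun l => ?_⟩
    rw [← hχX]
    have h3 := congrArg Matrix.transpose (hXB l p)
    simp only [Matrix.transpose_mul, Matrix.transpose_transpose, ← Matrix.kroneckerMap_transpose,
      Matrix.transpose_one] at h3
    rw [hAD, Matrix.mul_assoc, h3]
    simp only [Matrix.mul_assoc]
  choose c hc using hχ
  have hX : ∀ l p, UA * (M.obs l * mat (ψ p)) * UBᵀ = X l ⊗ₖ c p := fun l p => by
    rw [hχX, hc, ← Matrix.mul_kronecker_mul, Matrix.mul_one, Matrix.one_mul]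
  have hscale : ∀ (Z : Matrix (Fin 4) (Fin 4) ℂ) p,
      ((1 / 2 : ℂ) • Z) ⊗ₖ ((2 : ℂ) • c p) = Z ⊗ₖ c p := fun Z p => by
    rw [Matrix.smul_kronecker, Matrix.kronecker_smul, smul_smul]
    norm_num
  have hmat : ∀ p, mat (fun q : Fin kA × Fin kB => 2 * c p q.1 q.2) = (2 : ℂ) • c p :=
    fun p => rfl
  have hstate : ∀ p, (UA ⊗ₖ UB) *ᵥ ψ p =
      tensorState φ₄ (fun q : Fin kA × Fin kB => 2 * c p q.1 q.2) := fun p => by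
    apply mat_injective
    rw [mat_kronecker_mulVec, mat_tensorState, hc, mat_φ₄, hmat, hscale]
  -- The factor `2` compensates the `1/2` in `φ₄`. The auxiliary state is normalized because the
  -- isometries preserve the norm and `φ₄` is a unit vector.
  refine ⟨kA, kB, UA, UB, fun p q => 2 * c p q.1 q.2, hUA, hUB, ?_, fun p => ⟨hstate p,
    fun x a => ?_, fun y b => ?_⟩⟩
  · rw [← h1]
    refine Finset.sum_congr rfl fun p _ => ?_
    rw [← one_mul (_ ⬝ᵥ _), ← φ₄_unit, ← dotProduct_tensorState, ← hstate, Matrix.star_mulVec,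
      ← Matrix.dotProduct_mulVec, Matrix.mulVec_mulVec, Matrix.conjTranspose_kronecker,
      ← Matrix.mul_kronecker_mul, hUA, hUB, Matrix.one_kronecker_one, Matrix.one_mulVec]
  · apply mat_injective
    rw [mat_kronecker_mulVec, mat_kronecker_mulVec, mat_tensorState, mat_kronecker_mulVec, mat_φ₄,
      hmat, Matrix.transpose_one, Matrix.transpose_one, Matrix.mul_one, Matrix.mul_one,
      Matrix.mul_smul, Matrix.mul_one, hscale, M.E_eq_obs]
    simp only [quatStrategy, POVM.ofObs, Matrix.smul_mul, Matrix.mul_smul, Matrix.add_mul,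
      Matrix.mul_add, Matrix.one_mul, hc, hX, Matrix.smul_kronecker, Matrix.add_kronecker]
  · apply mat_injective
    -- On the state, each of Bob's actual observables equals a combination of Alice's, whose images
    -- are known.
    have h3 := (mat_relations_of_bellGap M N y.1 (hψ y.1 p)).1 y.2
    rw [mat_kronecker_mulVec, mat_kronecker_mulVec, mat_tensorState, mat_kronecker_mulVec, mat_φ₄,
      hmat, Matrix.one_mul, Matrix.one_mul, Matrix.smul_mul, Matrix.one_mul, hscale, N.E_eq_obs]
    simp only [quatStrategy, POVM.ofObs, Matrix.transpose_smul, Matrix.transpose_add,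
      Matrix.transpose_one, Y_transpose, h3, Matrix.smul_mul, Matrix.mul_smul, Matrix.add_mul,
      Matrix.mul_add, Matrix.mul_one, hc, hX, Matrix.smul_kronecker, Matrix.add_kronecker]

end Relations

/-! ### Pure and mixed strategies -/

theorem kronecker_one_mulVec_apply {m n P : Type*} [Fintype n] [Fintype P] [DecidableEq P]
    (K : Matrix m n ℂ) (v : n × P → ℂ) (i : m) (p : P) :
    ((K ⊗ₖ (1 : Matrix P P ℂ)) *ᵥ v) (i, p) = (K *ᵥ fun j => v (j, p)) i := by
  simp [Matrix.mulVec, dotProduct, Fintype.sum_prod_type, Matrix.one_apply]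

theorem trace_mul_of_isPurification {A B P : Type*} [Fintype A] [Fintype B] [Fintype P]
    {ρ : Matrix (A × B) (A × B) ℂ} {ψ : (A × B) × P → ℂ} (h : IsPurification ρ ψ)
    (K : Matrix (A × B) (A × B) ℂ) :
    (ρ * K).trace = ∑ p, star (fun i => ψ (i, p)) ⬝ᵥ K *ᵥ fun i => ψ (i, p) := by
  simp only [Matrix.trace, Matrix.diag_apply, Matrix.mul_apply, h _ _, dotProduct, Matrix.mulVec,
    Pi.star_apply, Finset.mul_sum, Finset.sum_mul]
  rw [Finset.sum_congr rfl fun i _ => Finset.sum_comm, Finset.sum_comm]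
  refine Finset.sum_congr rfl fun p _ => ?_
  rw [Finset.sum_comm]
  exact Finset.sum_congr rfl fun j _ => Finset.sum_congr rfl fun i _ => by ring

open scoped MatrixOrder Matrix.Norms.L2Operator in
theorem exists_isPurification {A B : Type*} [Fintype A] [DecidableEq A] [Fintype B]
    [DecidableEq B] {ρ : Matrix (A × B) (A × B) ℂ} (h : ρ.PosSemidef) :
    ∃ ψ : (A × B) × (A × B) → ℂ, IsPurification ρ ψ := by
  obtain ⟨Q, hQ⟩ := CStarAlgebra.nonneg_iff_eq_star_mul_self.mp h.nonneg
  -- With `ρ = QᴴQ`, the conjugated rows of `Q` are the components of a purification.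
  refine ⟨fun q => star (Q q.2 q.1), fun i j => ?_⟩
  rw [hQ]
  simp [Matrix.mul_apply, Matrix.star_apply]

section

variable {A B : Type*} [Fintype A] [DecidableEq A] [Fintype B] [DecidableEq B]

theorem sum_star_dotProduct_of_isPurification {P : Type*} [Fintype P]
    {ρ : Matrix (A × B) (A × B) ℂ} {ψ : (A × B) × P → ℂ}
    (h : IsPurification ρ ψ) (h1 : ρ.trace = 1) :
    ∑ p, star (fun i => ψ (i, p)) ⬝ᵥ (fun i => ψ (i, p)) = 1 := by
  have := trace_mul_of_isPurification h 1
  simpa only [Matrix.mul_one, h1, Matrix.one_mulVec] using this.symm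

theorem MixedStrategy.bellValue_le (S : MixedStrategy (Fin 4) (Fin 2) BobInput (Fin 2) A B) :
    S.bellValue ≤ 12 * √2 := by
  obtain ⟨ψ, hψ⟩ := exists_isPurification S.pos
  rw [MixedStrategy.bellValue, trace_mul_of_isPurification hψ]
  exact re_bellOp_le S.alice S.bob (ψ := fun p i => ψ (i, p))
    (sum_star_dotProduct_of_isPurification hψ S.trace_eq_one)

/-- Operators tensored with the identity of the purifying space act on each component separately, so
the family version applies and its auxiliary vectors reassemble into one. -/
theorem MixedStrategy.isMixedLocalDilation
    (S : MixedStrategy (Fin 4) (Fin 2) BobInput (Fin 2) A B) (hS : S.bellValue = 12 * √2) :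
    IsMixedLocalDilation S quatStrategy := by
  intro dP ψ hψ
  rw [MixedStrategy.bellValue, trace_mul_of_isPurification hψ] at hS
  obtain ⟨kA, kB, UA, UB, aux, hUA, hUB, haux, h⟩ := exists_dilation S.alice S.bob
    (ψ := fun p i => ψ (i, p)) (sum_star_dotProduct_of_isPurification hψ S.trace_eq_one) hS
  refine ⟨kA, kB, UA, UB, fun q => aux q.2 q.1, hUA, hUB, ?_, ?_, fun x a => ?_, fun y b => ?_⟩
  · rw [← haux]
    simp only [dotProduct]
    rw [Fintype.sum_prod_type, Finset.sum_comm]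
    rfl
  · funext ⟨q, p⟩
    rw [kronecker_one_mulVec_apply]
    exact congrFun (h p).1 q
  · funext ⟨q, p⟩
    simp only [kronecker_one_mulVec_apply]
    exact congrFun ((h p).2.1 x a) q
  · funext ⟨q, p⟩
    simp only [kronecker_one_mulVec_apply]
    exact congrFun ((h p).2.2 y b) q

theorem Strategy.bellValue_le (S : Strategy (Fin 4) (Fin 2) BobInput (Fin 2) A B) :
    S.bellValue ≤ 12 * √2 := by
  have := re_bellOp_le S.alice S.bob (ψ := fun _ : Unit => S.ψ) (by simpa using S.unit)
  simpa [Strategy.bellValue] using this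

theorem Strategy.isLocalDilation (S : Strategy (Fin 4) (Fin 2) BobInput (Fin 2) A B)
    (hS : S.bellValue = 12 * √2) : IsLocalDilation S quatStrategy := by
  obtain ⟨kA, kB, UA, UB, aux, hUA, hUB, haux, h⟩ := exists_dilation S.alice S.bob
    (ψ := fun _ : Unit => S.ψ) (by simpa using S.unit)
    (by simpa [Strategy.bellValue] using hS)
  exact ⟨kA, kB, UA, UB, aux (), hUA, hUB, by simpa using haux, h ()⟩

end

/-- The matrix of `φ₄` is scalar, so `Z ⊗ 1` and `1 ⊗ Zᵀ` agree on it; with observables squaring to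
one, every term of the sum of squares vanishes on `φ₄`. -/
theorem quatStrategy_bellValue : quatStrategy.bellValue = 12 * √2 := by
  have hA : ∀ l, quatStrategy.alice.obs l = X l := POVM.obs_ofObs X X_herm X_sq
  have hB : ∀ y, quatStrategy.bob.obs y = Y y := POVM.obs_ofObs Y Y_herm Y_sq
  have hd : ∀ Z W : Matrix (Fin 4) (Fin 4) ℂ, Z = Wᵀ → diffOp Z W *ᵥ φ₄ = 0 := fun Z W h => by
    rw [mul_mat_eq_of_diffOp, mat_φ₄, h]
    simp
  have hgap : ∀ q, bellGap quatStrategy.alice quatStrategy.bob q *ᵥ φ₄ = 0 := fun q => by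
    have h1 : diffOp (rsqrt2 • (X q.1.1 + X q.1.2)) (Y (q, 0)) *ᵥ φ₄ = 0 :=
      hd _ _ (by rw [Y_transpose]; simp)
    have h2 : diffOp (rsqrt2 • (X q.1.1 - X q.1.2)) (Y (q, 1)) *ᵥ φ₄ = 0 :=
      hd _ _ (by rw [Y_transpose]; simp [sub_eq_add_neg])
    simp only [bellGap, chsh_sumOfSquares, hA, hB, X_sq, Y_sq, sub_self, Matrix.zero_kronecker,
      Matrix.kronecker_zero, add_zero, Matrix.smul_mulVec, Matrix.add_mulVec,
      ← Matrix.mulVec_mulVec, h1, h2, Matrix.mulVec_zero, smul_zero]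
  have h := sum_re_bellGap quatStrategy.alice quatStrategy.bob (ψ := fun _ : Unit => φ₄)
    (by simpa using φ₄_unit)
  simp only [hgap, dotProduct_zero, Complex.zero_re, Finset.sum_const_zero, Finset.univ_unique,
    Finset.sum_singleton] at h
  exact (sub_eq_zero.mp h.symm).symm

end QuaternionSelfTest

end

open QuaternionSelfTest in
theorem mainTheorem3 :
    -- Alice's observables are anticommuting and represent the generators of the quaternion matrices
    (∀ l m : Fin 4, l ≠ m → X l * X m = -(X m * X l)) ∧
    (∃ Φ : Matrix (Fin 2) (Fin 2) ℍ[ℝ] →⋆ₐ[ℝ] Matrix (Fin 4) (Fin 4) ℂ,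
      Function.Injective Φ ∧ (∀ l, Φ (quatGen l) = X l) ∧
      Set.range Φ = (Algebra.adjoin ℝ (Set.range X) : Set (Matrix (Fin 4) (Fin 4) ℂ))) ∧
    -- the Bell inequality, its saturation, and the self-test, for pure states
    (∀ (dA dB : ℕ) (S : Strategy (Fin 4) (Fin 2) BobInput (Fin 2) (Fin dA) (Fin dB)),
      S.bellValue ≤ 12 * √2) ∧
    quatStrategy.bellValue = 12 * √2 ∧
    (∀ (dA dB : ℕ) (S : Strategy (Fin 4) (Fin 2) BobInput (Fin 2) (Fin dA) (Fin dB)),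
      S.bellValue = 12 * √2 → IsLocalDilation S quatStrategy) ∧
    -- the same for mixed states
    (∀ (dA dB : ℕ) (S : MixedStrategy (Fin 4) (Fin 2) BobInput (Fin 2) (Fin dA) (Fin dB)),
      S.bellValue ≤ 12 * √2) ∧
    (∀ (dA dB : ℕ) (S : MixedStrategy (Fin 4) (Fin 2) BobInput (Fin 2) (Fin dA) (Fin dB)),
      S.bellValue = 12 * √2 → IsMixedLocalDilation S quatStrategy) ∧
    -- the strategy is self-conjugate but not real
    quatStrategy.IsSelfConjugate ∧
    ¬ quatStrategy.IsReal := by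
  exact ⟨X_mul_of_ne, ⟨quatRep, quatRep_injective, quatRep_quatGen, range_quatRep⟩,
    fun _ _ S => S.bellValue_le, quatStrategy_bellValue, fun _ _ S => S.isLocalDilation,
    fun _ _ S => S.bellValue_le, fun _ _ S => S.isMixedLocalDilation,
    quatStrategy_isSelfConjugate, quatStrategy_not_isReal⟩
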